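/- An ordered transition system is $(X,\to,\le)$ with $\to\,\subseteq X\times X$ and $\le$ a quasi-ordering on $X$. It is a \emph{WBTS} if it is monotone (whenever $x\to y$ and $x'\ge x$, there is $y'\ge y$ with $x'\to^* y'$) and $(X,\le)$ has no infinite antichain; it is a \emph{WSTS} if moreover $\le$ is well-founded. For $d,w\in\mathbb N$, a \emph{weighted $(d,w)$-VASS} is a pair $(Q,T)$ with $Q$ a finite set of control states and $T\subseteq Q\times\mathbb Z^d\times\mathbb Z^w\times Q$ a finite set of transitions. It induces the transition system on configurations $q(u,v)\in Q\times\mathbb N^d\times\mathbb Z^w$ with $p(u,v)\to q(u',v')$ iff there is $(p,z,y,q)\in T$ with $u'=u+z$ (hence $u+z\ge 0$) and $v'=v+y$. Order configurations by $$q(u,v)\le q'(u',v')\iff q=q'\ \wedge\ \bigl(u<u'\ \vee\ (u=u'\wedge v\le_{\mathrm{lex}}v')\bigr),$$ where $u<u'$ is the strict part of the componentwise ordering of $\mathbb N^d$ and $\le_{\mathrm{lex}}$ is the lexicographic ordering of $\mathbb Z^w$. \textbf{Statement.} (1) Every weighted $(d,w)$-VASS is a WBTS under $\le$, and if $w\ge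 1$ and $Q\neq\emptyset$ it is not a WSTS. (2) Consider the class $(\mathcal S_i)_{i\in\mathbb N}$ of all weighted $(d,w)$-VASS with control states $\{0,\dots,n-1\}$, over all $d,w,n\in\mathbb N$, enumerated through a standard encoding of $(d,w,n,T)$ and with configurations given by a standard encoding in $\mathbb N$. This is a class of WBTS which is \emph{post-effective}: uniformly in $i$, it is decidable whether a number encodes a configuration of $\mathcal S_i$, the relations $\to$ and $\le$ of $\mathcal S_i$ are decidable, and the cardinality in $\mathbb N\cup\{\infty\}$ of the set of immediate successors of a configuration is computable. (3) The class is \emph{ideally effective}: the ideals (nonempty directed downward closed sets) of the $\mathcal S_i$ can be represented by natural numbers so that, uniformly in $i$, the set of codes of ideals of $\mathcal S_i$ is recursive; a code of the ideal ${\downarrow}x$ is computable from a code of the configuration $x$; inclusion of ideals is decidable; and, from a code of an ideal $I$, one can compute a finite list of codes of ideals whose union is the downward closure of the set of immediate successors of elements of $I$. (4) Consequently coverability is decidable for weighted VASS: there is an algorithm which, given $i$ and (codes of) two configurations $x,y$ of $\mathcal S_i$, decides whether $x\to^* y'$ for some $y'\ge y$. -/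

import Mathlib

/-- An ordered transition system: a set of states with a quasi-ordering and a transition
relation. -/
structure OrderedTS where
  State : Type*
  [order : Preorder State]
  step : State → State → Prop

attribute [instance] OrderedTS.order

namespace OrderedTS

/-- The set of immediate successors of a state. -/
def post (S : OrderedTS) (x : S.State) : Set S.State := {y | S.step x y}

/-- The set of immediate successors of a set of states. -/
def postSet (S : OrderedTS) (A : Set S.State) : Set S.State := {y | ∃ x ∈ A, S.step x y}

/-- Zero or more transition steps. -/
def steps (S : OrderedTS) : S.State → S.State → Prop := Relation.ReflTransGen S.step

/-- Upward monotonicity: a state above `x` can simulate a step from `x` in finitely many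
(possibly zero) steps. -/
def Monotone (S : OrderedTS) : Prop :=
  ∀ x x' y : S.State, S.step x y → x ≤ x' → ∃ y', y ≤ y' ∧ S.steps x' y'

/-- There is no infinite antichain. -/
def FiniteAntichains (S : OrderedTS) : Prop :=
  ∀ A : Set S.State, IsAntichain (· ≤ ·) A → A.Finite

/-- Well behaved transition systems. -/
def IsWBTS (S : OrderedTS) : Prop := S.Monotone ∧ S.FiniteAntichains

/-- Well structured transition systems: monotone, and the ordering is well-founded and has no
infinite antichain. -/
def IsWSTS (S : OrderedTS) : Prop :=
  S.Monotone ∧ WellFoundedLT S.State ∧ S.FiniteAntichains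

/-- The state `y` is coverable from `x`. -/
def Coverable (S : OrderedTS) (x y : S.State) : Prop := ∃ y', S.steps x y' ∧ y ≤ y'

end OrderedTS

/-- A countable class of ordered transition systems, given by an enumeration `sys 0, sys 1, …`
and a representation of states by natural numbers: `rep i e = some x` means that `e` encodes
the state `x` of `sys i`, and `rep i e = none` that `e` does not encode a state of `sys i`. -/
structure TSClass where
  sys : ℕ → OrderedTS.{0}
  rep : (i : ℕ) → ℕ → Option (sys i).State
  rep_surj : ∀ i x, ∃ e, rep i e = some x

namespace TSClass

/-- A partial recursive `M` that, on `(i, e, e')` where `e`, `e'` encode states `x`, `y` of the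
`i`-th system, halts and accepts exactly when `R i x y` holds. -/
def Decides (C : TSClass) (M : ℕ × ℕ × ℕ →. Bool)
    (R : (i : ℕ) → (C.sys i).State → (C.sys i).State → Prop) : Prop :=
  Partrec M ∧ ∀ i e e' x y, C.rep i e = some x → C.rep i e' = some y →
    ∃ b ∈ M (i, e, e'), (b = true ↔ R i x y)

/-- Whether `e` encodes a state of the `i`-th system is decidable, and so are, uniformly in `i`,
the transition relation and the ordering. -/
def Effective (C : TSClass) : Prop :=
  ComputablePred (fun p : ℕ × ℕ => (C.rep p.1 p.2).isSome = true) ∧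
  (∃ M, C.Decides M (fun i x y => (C.sys i).step x y)) ∧
  (∃ M, C.Decides M (fun _ x y => x ≤ y))

/-- Effective, and moreover the number of immediate successors of a state, an element of
`ℕ ∪ {∞}`, is computable (`none` stands for `∞`). -/
def PostEffective (C : TSClass) : Prop :=
  C.Effective ∧
  ∃ M : ℕ × ℕ →. Option ℕ, Partrec M ∧ ∀ i e x, C.rep i e = some x →
    ∃ k ∈ M (i, e), ((C.sys i).post x).encard = k.elim ⊤ (fun n => (n : ℕ∞))

/-- There is a representation `irep` of the ideals (`irep i e = some I` means that `e` encodes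
the ideal `I` of the `i`-th system) whose set of codes is recursive, for which principal ideals
are computable, inclusion is decidable, and the downward closure of the successors of an ideal
is computable as a finite union of ideals. -/
def IdeallyEffective (C : TSClass) : Prop :=
  ∃ irep : (i : ℕ) → ℕ → Option (Order.Ideal (C.sys i).State),
    (∀ i I, ∃ e, irep i e = some I) ∧
    ComputablePred (fun p : ℕ × ℕ => (irep p.1 p.2).isSome = true) ∧
    (∃ f : ℕ × ℕ →. ℕ, Partrec f ∧ ∀ i e x, C.rep i e = some x →
      ∃ c ∈ f (i, e), irep i c = some (Order.Ideal.principal x)) ∧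
    (∃ M : ℕ × ℕ × ℕ →. Bool, Partrec M ∧
      ∀ i e e' I J, irep i e = some I → irep i e' = some J →
        ∃ b ∈ M (i, e, e'), (b = true ↔ (I : Set (C.sys i).State) ⊆ J)) ∧
    (∃ f : ℕ × ℕ →. List ℕ, Partrec f ∧ ∀ i e I, irep i e = some I →
      ∃ l ∈ f (i, e), (∀ c ∈ l, (irep i c).isSome = true) ∧
        ∀ z, z ∈ lowerClosure ((C.sys i).postSet (I : Set (C.sys i).State)) ↔
          ∃ c ∈ l, ∃ J, irep i c = some J ∧ z ∈ J)

/-- On input `i` and two states of the `i`-th system, coverability of the second state from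
the first is decidable. -/
def CoverabilityDecidable (C : TSClass) : Prop :=
  ∃ M, C.Decides M (fun i x y => (C.sys i).Coverable x y)

end TSClass

/-- A weighted `(d, w)`-VASS with set of control states `Q`, given by its finite set of
transitions. -/
structure WeightedVASS (Q : Type*) (d w : ℕ) where
  T : Finset (Q × (Fin d → ℤ) × (Fin w → ℤ) × Q)

/-- A configuration `q(u, v)`. -/
structure WConfig (Q : Type*) (d w : ℕ) where
  q : Q
  u : Fin d → ℕ
  v : Fin w → ℤ

/-- Equal control states, and then either strictly smaller in `ℕ^d` (ordered componentwise), or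
equal in `ℕ^d` and lexicographically at most on `ℤ^w`. -/
instance WConfig.instPreorder (Q : Type*) (d w : ℕ) : Preorder (WConfig Q d w) where
  le x y := x.q = y.q ∧ (x.u < y.u ∨ (x.u = y.u ∧ toLex x.v ≤ toLex y.v))
  le_refl x := ⟨rfl, Or.inr ⟨rfl, le_rfl⟩⟩
  le_trans := by
    rintro x y z ⟨h1, h2⟩ ⟨h3, h4⟩
    refine ⟨h1.trans h3, ?_⟩
    rcases h2 with h2 | ⟨h2, h2'⟩ <;> rcases h4 with h4 | ⟨h4, h4'⟩
    · exact Or.inl (h2.trans h4)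
    · exact Or.inl (h4 ▸ h2)
    · exact Or.inl (h2 ▸ h4)
    · exact Or.inr ⟨h2.trans h4, h2'.trans h4'⟩

/-- The ordered transition system induced by a weighted VASS: a transition `(p, z, y, q)` leads
from `p(u, v)` to `q(u + z, v + y)` provided that `u + z` is nonnegative. -/
def WeightedVASS.toOrderedTS {Q : Type*} {d w : ℕ} (V : WeightedVASS Q d w) : OrderedTS where
  State := WConfig Q d w
  step x y := ∃ t ∈ V.T, t.1 = x.q ∧ t.2.2.2 = y.q ∧
    (∀ j, (y.u j : ℤ) = (x.u j : ℤ) + t.2.1 j) ∧ (∀ j, y.v j = x.v j + t.2.2.1 j)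

/-- A weighted `(d, w)`-VASS, for any `d` and `w`, with control states `0, …, n - 1`. -/
structure StdVASS where
  d : ℕ
  w : ℕ
  n : ℕ
  V : WeightedVASS (Fin n) d w

/-- A transition written with natural numbers and lists of integers. -/
def transData {n d w : ℕ} (t : Fin n × (Fin d → ℤ) × (Fin w → ℤ) × Fin n) :
    ℕ × List ℤ × List ℤ × ℕ :=
  (t.1.val, List.ofFn t.2.1, List.ofFn t.2.2.1, t.2.2.2.val)

theorem transData_injective {n d w : ℕ} :
    Function.Injective (transData (n := n) (d := d) (w := w)) := by
  rintro ⟨p, z, y, q⟩ ⟨p', z', y', q'⟩ h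
  simp only [transData, Prod.mk.injEq] at h
  obtain ⟨h1, h2, h3, h4⟩ := h
  rw [Fin.ext h1, Fin.ext h4, List.ofFn_injective h2, List.ofFn_injective h3]

/-- The weighted VASS described by `(d, w, n, L)`: its transitions are those listed in `L`
(entries of `L` that do not describe a transition for `d`, `w`, `n` are ignored). -/
noncomputable def StdVASS.ofData (r : ℕ × ℕ × ℕ × List (ℕ × List ℤ × List ℤ × ℕ)) :
    StdVASS where
  d := r.1
  w := r.2.1
  n := r.2.2.1
  V := ⟨((List.finite_toSet r.2.2.2).preimage transData_injective.injOn).toFinset⟩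

/-- The standard enumeration of all weighted VASS, through the standard bijection between natural
numbers and finite descriptions. -/
noncomputable def StdVASS.enum (i : ℕ) : StdVASS := StdVASS.ofData (Denumerable.ofNat _ i)

theorem StdVASS.ofData_surjective : Function.Surjective StdVASS.ofData := by
  rintro ⟨d, w, n, ⟨T⟩⟩
  refine ⟨(d, w, n, T.toList.map transData), ?_⟩
  have h : ((List.finite_toSet (T.toList.map transData)).preimage
      transData_injective.injOn).toFinset = T := by
    ext t
    rw [Set.Finite.mem_toFinset]
    change transData t ∈ T.toList.map transData ↔ _
    rw [List.mem_map_of_injective transData_injective, Finset.mem_toList]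
  simp only [StdVASS.ofData, h]

theorem StdVASS.enum_surjective : Function.Surjective StdVASS.enum :=
  StdVASS.ofData_surjective.comp fun r => ⟨Encodable.encode r, Denumerable.ofNat_encode r⟩

/-- The configuration encoded by a natural number, read as `(q, u, v)` with `u` and `v` lists;
`none` if the number `q` is not a control state or a list does not have the right length. -/
def WConfig.ofCode (n d w e : ℕ) : Option (WConfig (Fin n) d w) :=
  let r : ℕ × List ℕ × List ℤ := Denumerable.ofNat _ e
  if h : r.1 < n ∧ r.2.1.length = d ∧ r.2.2.length = w then
    some ⟨⟨r.1, h.1⟩, fun j => r.2.1.get (j.cast h.2.1.symm),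
      fun j => r.2.2.get (j.cast h.2.2.symm)⟩
  else none

theorem WConfig.ofCode_surj {n d w : ℕ} (x : WConfig (Fin n) d w) :
    ∃ e, WConfig.ofCode n d w e = some x := by
  refine ⟨Encodable.encode (x.q.val, List.ofFn x.u, List.ofFn x.v), ?_⟩
  simp [WConfig.ofCode, Fin.cast]

/-- The class of all weighted VASS, with the standard encoding of systems and of states. -/
noncomputable def weightedVASSClass : TSClass where
  sys i := (StdVASS.enum i).V.toOrderedTS
  rep i e := WConfig.ofCode (StdVASS.enum i).n (StdVASS.enum i).d (StdVASS.enum i).w e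
  rep_surj _ x := WConfig.ofCode_surj x

/-!
The ideals of `Q × ℕ^d × ℤ^w` under the ordering of configurations are described by *extended
configurations*, in which coordinates may be `⊤`: the ideal of `g` is the set of configurations
below `g`, for the ordering defined by the same formula (`ExtConfig.Valid.ideal`). With the
normalization `ExtConfig.Valid` this description is unique: inclusion of ideals is the ordering of
the extended configurations (`ExtConfig.Valid.le_iff`). Firing a transition is a translation, hence
an automorphism of the ordering when nonnegativity of the counters is disregarded. Together with an
interpolation property (`ExtConfig.Valid.exists_between`) this shows that the downward closure of
the successors of an ideal is the union of the ideals obtained by firing transitions at its bound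
(`ExtConfig.Valid.mem_lowerClosure_postSet_iff`).

Every downward closed set of configurations is a finite union of such ideals
(`ExtConfig.exists_list_of_isLowerSet`): the set of occurring counter values is a finite union of
boxes with possibly infinite sides, and within a box the weights matter only at its corner, where
they form a downward closed set of the linear order `ℤ^w`. In particular there are no other ideals
(`ExtConfig.exists_valid_of_ideal`). Moreover, the set of configurations coverable from `x` being
downward closed and closed under steps, non-coverability of `y` from `x` is witnessed by a finite
list of extended configurations (`WeightedVASS.not_coverable_iff`).

On lists of integers all of this is primitive recursive, for any set of control states and any
dimensions at once. Coverability is then recursively enumerable by forward search, and so is its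
complement by search for a witness; Post's theorem makes it decidable.
-/

/-! ### Extended configurations -/

/-- A configuration in which coordinates may take the value `⊤`. Counters range over all of
`ℤ ∪ {⊤}` rather than `ℕ ∪ {⊤}`, so that firing a transition is a translation, which can be undone
by the opposite translation; nonnegativity is required separately. -/
@[ext]
structure ExtConfig (Q : Type*) (d w : ℕ) where
  q : Q
  u : Fin d → WithTop ℤ
  v : Fin w → WithTop ℤ

/-- Comparing with respect to the lexicographic ordering is not affected by strictly monotone maps
in the coordinates. -/
theorem toLex_map_le_iff {w : ℕ} {α β : Type*} [LinearOrder α] [LinearOrder β]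
    {f : Fin w → α → β} (hf : ∀ j, StrictMono (f j)) (v v' : Fin w → α) :
    toLex (fun j => f j (v j)) ≤ toLex (fun j => f j (v' j)) ↔ toLex v ≤ toLex v' := by
  rw [← not_lt, ← not_lt, not_iff_not]
  change (∃ i, (∀ j < i, f j (v' j) = f j (v j)) ∧ f i (v' i) < f i (v i)) ↔
    ∃ i, (∀ j < i, v' j = v j) ∧ v' i < v i
  simp only [(hf _).lt_iff_lt, (hf _).injective.eq_iff]

namespace ExtConfig

variable {Q : Type*} {d w : ℕ}

/-- The ordering of configurations, extended by the same formula. -/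
instance instPreorder : Preorder (ExtConfig Q d w) where
  le x y := x.q = y.q ∧ (x.u < y.u ∨ (x.u = y.u ∧ toLex x.v ≤ toLex y.v))
  le_refl x := ⟨rfl, Or.inr ⟨rfl, le_rfl⟩⟩
  le_trans := by
    rintro x y z ⟨h1, h2⟩ ⟨h3, h4⟩
    refine ⟨h1.trans h3, ?_⟩
    rcases h2 with h2 | ⟨h2, h2'⟩ <;> rcases h4 with h4 | ⟨h4, h4'⟩
    · exact Or.inl (h2.trans h4)
    · exact Or.inl (h4 ▸ h2)
    · exact Or.inl (h2 ▸ h4)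
    · exact Or.inr ⟨h2.trans h4, h2'.trans h4'⟩

theorem le_def {x y : ExtConfig Q d w} :
    x ≤ y ↔ x.q = y.q ∧ (x.u < y.u ∨ (x.u = y.u ∧ toLex x.v ≤ toLex y.v)) := Iff.rfl

theorem q_eq_of_le {x y : ExtConfig Q d w} (h : x ≤ y) : x.q = y.q := h.1

theorem u_le_of_le {x y : ExtConfig Q d w} (h : x ≤ y) : x.u ≤ y.u :=
  h.2.elim le_of_lt fun h => h.1.le

/-- The extended configuration with the given integer coordinates. -/
def ofInt (q : Q) (u : Fin d → ℤ) (v : Fin w → ℤ) : ExtConfig Q d w :=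
  ⟨q, fun j => (u j : WithTop ℤ), fun j => (v j : WithTop ℤ)⟩

theorem ofInt_le_ofInt {q q' : Q} {u u' : Fin d → ℤ} {v v' : Fin w → ℤ} :
    ofInt q u v ≤ ofInt q' u' v' ↔
      q = q' ∧ (u < u' ∨ (u = u' ∧ toLex v ≤ toLex v')) := by
  have h1 : (fun j => (u j : WithTop ℤ)) < (fun j => (u' j : WithTop ℤ)) ↔ u < u' := by
    simp only [lt_iff_le_not_ge, Pi.le_def, WithTop.coe_le_coe]
  have h2 : (fun j => (u j : WithTop ℤ)) = (fun j => (u' j : WithTop ℤ)) ↔ u = u' := by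
    simp only [funext_iff, WithTop.coe_inj]
  rw [le_def]
  simp only [ofInt]
  rw [h1, h2, toLex_map_le_iff (f := fun _ => WithTop.some) fun _ => WithTop.coe_strictMono]

/-- Those extended configurations that stand for an ideal: counters are nonnegative, the coordinates
`⊤` of the weight form a final segment, and the weight is `⊤` throughout as soon as some counter is
unbounded. -/
structure Valid (g : ExtConfig Q d w) : Prop where
  nonneg : ∀ j, 0 ≤ g.u j
  top_of_le : ∀ i j, i ≤ j → g.v i = ⊤ → g.v j = ⊤
  v_eq_top : ∀ i, g.u i = ⊤ → ∀ j, g.v j = ⊤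

/-- The effect of a transition on an extended configuration, whether or not it may be fired. -/
def fire (t : Q × (Fin d → ℤ) × (Fin w → ℤ) × Q) (g : ExtConfig Q d w) : ExtConfig Q d w :=
  ⟨t.2.2.2, fun j => g.u j + (t.2.1 j : WithTop ℤ), fun j => g.v j + (t.2.2.1 j : WithTop ℤ)⟩

/-- A transition may be fired if it starts in the current control state and leaves the counters
nonnegative. -/
def Fireable (t : Q × (Fin d → ℤ) × (Fin w → ℤ) × Q) (g : ExtConfig Q d w) : Prop :=
  t.1 = g.q ∧ ∀ j, 0 ≤ g.u j + (t.2.1 j : WithTop ℤ)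

theorem add_coe_strictMono (z : ℤ) : StrictMono fun a : WithTop ℤ => a + (z : WithTop ℤ) :=
  fun _ _ h => WithTop.add_lt_add_right WithTop.coe_ne_top h

theorem fire_le_fire_iff (t : Q × (Fin d → ℤ) × (Fin w → ℤ) × Q) {g g' : ExtConfig Q d w}
    (hq : g.q = g'.q) : fire t g ≤ fire t g' ↔ g ≤ g' := by
  have h1 : (fire t g).u < (fire t g').u ↔ g.u < g'.u := by
    simp only [lt_iff_le_not_ge, Pi.le_def, fire, (add_coe_strictMono _).le_iff_le]
  have h2 : (fire t g).u = (fire t g').u ↔ g.u = g'.u := by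
    simp only [funext_iff, fire, (add_coe_strictMono _).injective.eq_iff]
  have h3 : toLex (fire t g).v ≤ toLex (fire t g').v ↔ toLex g.v ≤ toLex g'.v :=
    toLex_map_le_iff (fun j => add_coe_strictMono (t.2.2.1 j)) g.v g'.v
  rw [le_def, le_def, h1, h2, h3]
  exact and_congr_left' ⟨fun _ => hq, fun _ => rfl⟩

theorem Fireable.mono {t : Q × (Fin d → ℤ) × (Fin w → ℤ) × Q} {g g' : ExtConfig Q d w}
    (h : Fireable t g) (hg : g ≤ g') : Fireable t g' :=
  ⟨h.1.trans hg.1, fun j => (h.2 j).trans ((add_coe_strictMono _).monotone (u_le_of_le hg j))⟩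

theorem Valid.valid_fire {t : Q × (Fin d → ℤ) × (Fin w → ℤ) × Q} {g : ExtConfig Q d w} (hg : g.Valid)
    (h : Fireable t g) : (fire t g).Valid := by
  have key : ∀ (a : WithTop ℤ) (z : ℤ), a + (z : WithTop ℤ) = ⊤ ↔ a = ⊤ := fun a z => by
    rw [WithTop.add_eq_top]; simp
  refine ⟨h.2, fun i j hij hi => ?_, fun i hi j => ?_⟩
  · exact (key _ _).2 (hg.top_of_le i j hij ((key _ _).1 hi))
  · exact (key _ _).2 (hg.v_eq_top i ((key _ _).1 hi) j)

end ExtConfig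

namespace WConfig

variable {Q : Type*} {d w : ℕ}

/-- A configuration, seen as an extended one. -/
def toExt (x : WConfig Q d w) : ExtConfig Q d w := ExtConfig.ofInt x.q (fun j => (x.u j : ℤ)) x.v

theorem toExt_le_toExt {x y : WConfig Q d w} : x.toExt ≤ y.toExt ↔ x ≤ y := by
  have h1 : (fun j => (x.u j : ℤ)) < (fun j => (y.u j : ℤ)) ↔ x.u < y.u := by
    simp only [lt_iff_le_not_ge, Pi.le_def, Nat.cast_le]
  have h2 : (fun j => (x.u j : ℤ)) = (fun j => (y.u j : ℤ)) ↔ x.u = y.u := by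
    simp only [funext_iff, Nat.cast_inj]
  rw [toExt, toExt, ExtConfig.ofInt_le_ofInt, h1, h2]
  rfl

theorem toExt_injective : Function.Injective (toExt (Q := Q) (d := d) (w := w)) := by
  rintro ⟨q, u, v⟩ ⟨q', u', v'⟩ h
  simp only [toExt, ExtConfig.ofInt, ExtConfig.mk.injEq, funext_iff, WithTop.coe_inj,
    Nat.cast_inj] at h
  obtain ⟨rfl, h2, h3⟩ := h
  rw [funext h2, funext h3]

theorem toExt_valid (x : WConfig Q d w) : x.toExt.Valid where
  nonneg j := by
    change ((0 : ℤ) : WithTop ℤ) ≤ ((x.u j : ℤ) : WithTop ℤ)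
    exact WithTop.coe_le_coe.2 (Int.natCast_nonneg _)
  top_of_le i _ _ h := absurd h WithTop.coe_ne_top
  v_eq_top i h := absurd h WithTop.coe_ne_top

end WConfig

theorem WeightedVASS.step_iff {Q : Type*} {d w : ℕ} {V : WeightedVASS Q d w}
    {x y : WConfig Q d w} : V.toOrderedTS.step x y ↔
      ∃ t ∈ V.T, ExtConfig.Fireable t x.toExt ∧ y.toExt = ExtConfig.fire t x.toExt := by
  constructor
  · rintro ⟨t, ht, h1, h2, h3, h4⟩
    refine ⟨t, ht, ⟨h1, fun j => ?_⟩, ?_⟩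
    · change ((0 : ℤ) : WithTop ℤ) ≤ ((x.u j + t.2.1 j : ℤ) : WithTop ℤ)
      rw [← h3 j]
      exact WithTop.coe_le_coe.2 (Int.natCast_nonneg _)
    · refine ExtConfig.ext h2.symm (funext fun j => ?_) (funext fun j => ?_)
      · exact congrArg WithTop.some (h3 j)
      · exact congrArg WithTop.some (h4 j)
  · rintro ⟨t, ht, ⟨h1, -⟩, h⟩
    refine ⟨t, ht, h1, (congrArg ExtConfig.q h).symm, fun j => ?_, fun j => ?_⟩
    · exact WithTop.coe_injective (congrFun (congrArg ExtConfig.u h) j)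
    · exact WithTop.coe_injective (congrFun (congrArg ExtConfig.v h) j)

/-! ### Ideals given by extended configurations -/

namespace ExtConfig

variable {Q : Type*} {d w : ℕ}

theorem exists_toExt_eq_fire {t : Q × (Fin d → ℤ) × (Fin w → ℤ) × Q} {x : WConfig Q d w}
    (h : Fireable t x.toExt) : ∃ y : WConfig Q d w, y.toExt = fire t x.toExt := by
  refine ⟨⟨t.2.2.2, fun j => (x.u j + t.2.1 j).toNat, fun j => x.v j + t.2.2.1 j⟩, ?_⟩
  refine ExtConfig.ext rfl (funext fun j => ?_) rfl
  have := h.2 j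
  change ((0 : ℤ) : WithTop ℤ) ≤ ((x.u j + t.2.1 j : ℤ) : WithTop ℤ) at this
  exact congrArg WithTop.some (Int.toNat_of_nonneg (WithTop.coe_le_coe.1 this))

theorem coe_untopD_zero_le (a : WithTop ℤ) : ((a.untopD 0 : ℤ) : WithTop ℤ) ≤ a := by
  rcases a with _ | m
  · exact le_top
  · exact le_refl (WithTop.some m)

/-- Interpolation: below a valid `g`, any two elements with integer coordinates, possibly negative,
have a common upper bound that is a configuration, and whose counters may be prescribed to be
large within `g`. -/
theorem Valid.exists_between {g : ExtConfig Q d w} (hg : g.Valid) {c : Fin d → ℕ}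
    (hc : ∀ j, ((c j : ℤ) : WithTop ℤ) ≤ g.u j) {a b : Fin d → ℤ} {a' b' : Fin w → ℤ}
    (ha : ofInt g.q a a' ≤ g) (hb : ofInt g.q b b' ≤ g) :
    ∃ x : WConfig Q d w, x.toExt ≤ g ∧ (∀ j, c j ≤ x.u j) ∧
      ofInt g.q a a' ≤ x.toExt ∧ ofInt g.q b b' ≤ x.toExt := by
  by_cases htop : ∃ i, g.u i = ⊤
  · -- An unbounded counter can be chosen strictly above everything prescribed, so that the
    -- weights play no role.
    obtain ⟨i, hi⟩ := htop
    let u : Fin d → ℕ := fun j =>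
      ((g.u j).untopD (max (max (a j) (b j)) (c j) + 1)).toNat
    have hcase : ∀ j, (g.u j = ⊤ ∧ a j < u j ∧ b j < u j ∧ c j < u j) ∨
        g.u j = ((u j : ℤ) : WithTop ℤ) := by
      intro j
      have h0 := hg.nonneg j
      rcases hj : g.u j with _ | m
      · left
        have : u j = (max (max (a j) (b j)) (c j) + 1).toNat := by simp only [u, hj]; rfl
        refine ⟨rfl, ?_, ?_, ?_⟩ <;> omega
      · right
        have h1 : u j = m.toNat := by simp only [u, hj]; rfl
        rw [hj] at h0
        have h2 : 0 ≤ m := WithTop.coe_le_coe.1 h0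
        rw [h1, Int.toNat_of_nonneg h2]
        rfl
    have hlt : ∀ {p : Fin d → ℤ} {p' : Fin w → ℤ}, (∀ j, g.u j = ⊤ → p j < u j) →
        ofInt g.q p p' ≤ g → ofInt g.q p p' ≤ ofInt g.q (fun j => (u j : ℤ)) 0 := by
      intro p p' hp hle
      rw [ofInt_le_ofInt]
      refine ⟨rfl, Or.inl (Pi.lt_def.2 ⟨fun j => ?_, i, hp i hi⟩)⟩
      rcases hcase j with h | h
      · exact (hp j h.1).le
      · have := u_le_of_le hle j
        rw [h] at this
        exact WithTop.coe_le_coe.1 this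
    refine ⟨⟨g.q, u, 0⟩, ⟨rfl, Or.inl (Pi.lt_def.2 ⟨fun j => ?_, i, ?_⟩)⟩, fun j => ?_,
      hlt (fun j hj => ?_) ha, hlt (fun j hj => ?_) hb⟩
    · rcases hcase j with h | h
      · rw [h.1]; exact le_top
      · exact h.ge
    · rw [hi]; exact WithTop.coe_lt_top _
    · rcases hcase j with h | h
      · exact h.2.2.2.le
      · have := hc j
        rw [h] at this
        exact_mod_cast WithTop.coe_le_coe.1 this
    · rcases hcase j with h | h
      · exact h.2.1
      · rw [h] at hj; exact absurd hj WithTop.coe_ne_top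
    · rcases hcase j with h | h
      · exact h.2.2.1
      · rw [h] at hj; exact absurd hj WithTop.coe_ne_top
  · -- All counters are finite; the bounds whose counters agree with `g` determine the weight.
    push Not at htop
    obtain ⟨u, hu⟩ : ∃ u : Fin d → ℕ, g.u = fun j => ((u j : ℤ) : WithTop ℤ) := by
      refine ⟨fun j => ((g.u j).untop (htop j)).toNat, funext fun j => ?_⟩
      have h0 := hg.nonneg j
      rw [Int.toNat_of_nonneg, WithTop.coe_untop]
      exact (WithTop.le_untop_iff _).2 h0
    have hbase : ∃ v : Fin w → ℤ, toLex (fun j => (v j : WithTop ℤ)) ≤ toLex g.v := by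
      exact ⟨fun j => (g.v j).untopD 0, Pi.toLex_monotone fun j => coe_untopD_zero_le _⟩
    obtain ⟨v₀, hv₀⟩ := hbase
    have hcand : ∀ (p : Fin d → ℤ) (p' : Fin w → ℤ), ofInt g.q p p' ≤ g →
        ∃ v : Fin w → ℤ, toLex (fun j => (v j : WithTop ℤ)) ≤ toLex g.v ∧
          ∀ v' : Fin w → ℤ, toLex v ≤ toLex v' →
            ofInt g.q p p' ≤ ofInt g.q (fun j => (u j : ℤ)) v' := by
      rintro p p' ⟨-, h⟩
      rcases h with h | ⟨h, h'⟩
      · refine ⟨v₀, hv₀, fun v' _ => ⟨rfl, Or.inl ?_⟩⟩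
        rw [hu] at h
        exact h
      · refine ⟨p', h', fun v' hv' => ofInt_le_ofInt.2 ⟨rfl, Or.inr ⟨?_, hv'⟩⟩⟩
        rw [hu] at h
        exact funext fun j => WithTop.coe_injective (congrFun h j)
    obtain ⟨v₁, h₁, h₁'⟩ := hcand a a' ha
    obtain ⟨v₂, h₂, h₂'⟩ := hcand b b' hb
    have hcu : ∀ j, c j ≤ u j := fun j => by
      have := hc j
      rw [hu] at this
      exact_mod_cast WithTop.coe_le_coe.1 this
    rcases le_total (toLex v₁) (toLex v₂) with h | h
    · exact ⟨⟨g.q, u, v₂⟩, ⟨rfl, Or.inr ⟨hu.symm, h₂⟩⟩, hcu, h₁' v₂ h, h₂' v₂ le_rfl⟩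
    · exact ⟨⟨g.q, u, v₁⟩, ⟨rfl, Or.inr ⟨hu.symm, h₁⟩⟩, hcu, h₁' v₁ le_rfl, h₂' v₁ h⟩

/-- Some element with integer coordinates lies below `g`, as a starting point for interpolation. -/
theorem exists_ofInt_le (g : ExtConfig Q d w) : ∃ a a', ofInt g.q a a' ≤ g := by
  refine ⟨fun j => (g.u j).untopD 0, fun j => (g.v j).untopD 0, rfl, ?_⟩
  rcases lt_or_eq_of_le (show (fun j => (((g.u j).untopD 0 : ℤ) : WithTop ℤ)) ≤ g.u from
    fun j => coe_untopD_zero_le _) with h | h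
  · exact Or.inl h
  · exact Or.inr ⟨h, Pi.toLex_monotone fun j => coe_untopD_zero_le _⟩

/-- The ideal of all configurations below a valid extended configuration. -/
def Valid.ideal {g : ExtConfig Q d w} (hg : g.Valid) : Order.Ideal (WConfig Q d w) where
  carrier := {x | x.toExt ≤ g}
  lower' _ _ hyx hx := (WConfig.toExt_le_toExt.2 hyx).trans hx
  nonempty' := by
    obtain ⟨a, a', h⟩ := exists_ofInt_le g
    obtain ⟨x, hx, -⟩ := hg.exists_between (c := 0) hg.nonneg h h
    exact ⟨x, hx⟩
  directed' x hx y hy := by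
    obtain ⟨z, hz, -, h₁, h₂⟩ := hg.exists_between (c := 0) hg.nonneg
      (a := fun j => (x.u j : ℤ)) (a' := x.v) (b := fun j => (y.u j : ℤ)) (b' := y.v)
      (by rw [← q_eq_of_le hx]; exact hx) (by rw [← q_eq_of_le hy]; exact hy)
    refine ⟨z, hz, WConfig.toExt_le_toExt.1 ?_, WConfig.toExt_le_toExt.1 ?_⟩
    · rw [← q_eq_of_le hx] at h₁; exact h₁
    · rw [← q_eq_of_le hy] at h₂; exact h₂

/-- A weight is determined by the finite weights below it, provided that its coordinates `⊤` form a
final segment. -/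
theorem toLex_le_of_forall_coe_le {v v' : Fin w → WithTop ℤ}
    (hv' : ∀ i j, i ≤ j → v' i = ⊤ → v' j = ⊤)
    (h : ∀ y : Fin w → ℤ, toLex (fun j => (y j : WithTop ℤ)) ≤ toLex v →
      toLex (fun j => (y j : WithTop ℤ)) ≤ toLex v') : toLex v ≤ toLex v' := by
  by_contra hlt
  obtain ⟨i, heq, hi⟩ : ∃ i, (∀ j < i, v' j = v j) ∧ v' i < v i := not_le.1 hlt
  obtain ⟨m, hm⟩ := WithTop.ne_top_iff_exists.1 hi.ne_top
  -- Increasing the first differing coordinate of `v'` by one stays within `v`.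
  let y : Fin w → ℤ := fun j => if j = i then m + 1 else (v j).untopD 0
  have hy : toLex (fun j => (y j : WithTop ℤ)) ≤ toLex v := by
    refine Pi.toLex_monotone fun j => ?_
    by_cases hj : j = i
    · subst hj
      simp only [y, if_true]
      rw [← hm] at hi
      rcases hvj : v j with _ | k
      · exact le_top
      · rw [hvj] at hi
        exact WithTop.coe_le_coe.2 (WithTop.coe_lt_coe.1 hi)
    · simp only [y, hj, if_false]
      exact coe_untopD_zero_le _
  refine absurd (h y hy) (not_le.2 ⟨i, fun j hj => ?_, ?_⟩)
  · change v' j = (y j : WithTop ℤ)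
    have hne : v' j ≠ ⊤ := fun h' => hi.ne_top (hv' j i hj.le h')
    rw [heq j hj] at hne ⊢
    obtain ⟨k, hk⟩ := WithTop.ne_top_iff_exists.1 hne
    simp only [y, hj.ne, if_false, ← hk]
    rfl
  · change v' i < (y i : WithTop ℤ)
    simp only [y, if_true, ← hm]
    exact WithTop.coe_lt_coe.2 (lt_add_one m)

/-- Inclusion of the ideals of two valid extended configurations is their ordering. -/
theorem Valid.le_iff {g g' : ExtConfig Q d w} (hg : g.Valid) (hg' : g'.Valid) :
    g ≤ g' ↔ ∀ x : WConfig Q d w, x.toExt ≤ g → x.toExt ≤ g' := by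
  refine ⟨fun h x hx => hx.trans h, fun h => ?_⟩
  obtain ⟨a, a', ha⟩ := exists_ofInt_le g
  have hq : g.q = g'.q := by
    obtain ⟨x, hx, -⟩ := hg.exists_between (c := 0) hg.nonneg ha ha
    exact (q_eq_of_le hx).symm.trans (q_eq_of_le (h x hx))
  have hu : g.u ≤ g'.u := by
    intro j
    by_contra hlt
    rw [not_le] at hlt
    obtain ⟨m, hm⟩ := WithTop.ne_top_iff_exists.1 hlt.ne_top
    have h0 := hg'.nonneg j
    rw [← hm] at h0 hlt
    have h0' : 0 ≤ m := WithTop.coe_le_coe.1 h0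
    have hc : ∀ k, (((if k = j then m.toNat + 1 else 0 : ℕ) : ℤ) : WithTop ℤ) ≤ g.u k := by
      intro k
      by_cases hk : k = j
      · subst hk
        rcases hgk : g.u k with _ | l
        · exact le_top
        · rw [hgk] at hlt
          have : m < l := WithTop.coe_lt_coe.1 hlt
          refine WithTop.coe_le_coe.2 ?_
          rw [if_pos rfl]
          omega
      · rw [if_neg hk]
        exact hg.nonneg k
    obtain ⟨x, hx, hcx, -⟩ := hg.exists_between hc ha ha
    have h1 := hcx j
    have h2 := u_le_of_le (h x hx) j
    rw [← hm] at h2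
    have h3 : (x.u j : ℤ) ≤ m := WithTop.coe_le_coe.1 h2
    rw [if_pos rfl] at h1
    omega
  refine ⟨hq, ?_⟩
  rcases lt_or_eq_of_le hu with hu | hu
  · exact Or.inl hu
  refine Or.inr ⟨hu, ?_⟩
  by_cases htop : ∃ i, g.u i = ⊤
  · obtain ⟨i, hi⟩ := htop
    refine Pi.toLex_monotone fun j => ?_
    rw [hg'.v_eq_top i (hu ▸ hi) j]
    exact le_top
  · push Not at htop
    refine toLex_le_of_forall_coe_le hg'.top_of_le fun y hy => ?_
    have hgu : ∀ j, g.u j = ((((g.u j).untop (htop j)).toNat : ℤ) : WithTop ℤ) := fun j => by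
      rw [Int.toNat_of_nonneg, WithTop.coe_untop]
      exact (WithTop.le_untop_iff _).2 (hg.nonneg j)
    have := h ⟨g.q, fun j => ((g.u j).untop (htop j)).toNat, y⟩
      ⟨rfl, Or.inr ⟨(funext hgu).symm, hy⟩⟩
    rcases this.2 with h' | h'
    · exact absurd ((funext hgu).symm.trans hu) h'.ne
    · exact h'.2

/-- An ideal contained in a finite union of sets `{x | x ≤ g}` is contained in one of them, by
directedness. -/
theorem exists_forall_le_of_ideal (I : Order.Ideal (WConfig Q d w)) (L : List (ExtConfig Q d w))
    (hcov : ∀ x ∈ I, ∃ g ∈ L, x.toExt ≤ g) : ∃ g ∈ L, ∀ x ∈ I, x.toExt ≤ g := by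
  by_contra! hno
  suffices ∃ x ∈ I, ∀ g ∈ L, ¬ x.toExt ≤ g by
    obtain ⟨x, hx, hx'⟩ := this
    obtain ⟨g, hg, hxg⟩ := hcov x hx
    exact hx' g hg hxg
  clear hcov
  induction L with
  | nil =>
    obtain ⟨x, hx⟩ := I.nonempty
    exact ⟨x, hx, by simp⟩
  | cons g L ih =>
    obtain ⟨x, hx, hxL⟩ := ih fun g' hg' => hno g' (List.mem_cons_of_mem _ hg')
    obtain ⟨y, hy, hyg⟩ := hno g List.mem_cons_self
    obtain ⟨z, hz, hxz, hyz⟩ := I.directed x hx y hy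
    rw [← WConfig.toExt_le_toExt] at hxz hyz
    refine ⟨z, hz, fun g' hg' => ?_⟩
    rcases List.mem_cons.1 hg' with rfl | hg'
    · exact fun hle => hyg (hyz.trans hle)
    · exact fun hle => hxL g' hg' (hxz.trans hle)

theorem Valid.exists_le_of_forall_exists_le {h : ExtConfig Q d w} (hh : h.Valid)
    {L : List (ExtConfig Q d w)} (hL : ∀ g ∈ L, g.Valid)
    (hcov : ∀ x : WConfig Q d w, x.toExt ≤ h → ∃ g ∈ L, x.toExt ≤ g) : ∃ g ∈ L, h ≤ g := by
  obtain ⟨g, hg, hle⟩ := exists_forall_le_of_ideal hh.ideal L hcov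
  exact ⟨g, hg, (hh.le_iff (hL g hg)).2 hle⟩

/-- The downward closure of the successors of an ideal: each transition that may be fired
translates the bound of the ideal. -/
theorem Valid.mem_lowerClosure_postSet_iff (V : WeightedVASS Q d w) {g : ExtConfig Q d w}
    (hg : g.Valid) (z : WConfig Q d w) :
    (∃ y x : WConfig Q d w, x.toExt ≤ g ∧ V.toOrderedTS.step x y ∧ z ≤ y) ↔
      ∃ t ∈ V.T, Fireable t g ∧ z.toExt ≤ fire t g := by
  constructor
  · rintro ⟨y, x, hx, hstep, hzy⟩
    obtain ⟨t, ht, hf, hy⟩ := WeightedVASS.step_iff.1 hstep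
    refine ⟨t, ht, hf.mono hx, (WConfig.toExt_le_toExt.2 hzy).trans ?_⟩
    rw [hy, fire_le_fire_iff t (q_eq_of_le hx)]
    exact hx
  · rintro ⟨t, ht, hf, hz⟩
    -- Undo the translation, then interpolate with counters large enough for firing `t`.
    have hback : z.toExt = fire t
        (ofInt g.q (fun j => (z.u j : ℤ) - t.2.1 j) (fun j => z.v j - t.2.2.1 j)) := by
      refine ExtConfig.ext (show z.q = t.2.2.2 from q_eq_of_le hz) (funext fun j => ?_)
        (funext fun j => ?_)
      · exact congrArg WithTop.some (sub_add_cancel (z.u j : ℤ) (t.2.1 j)).symm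
      · exact congrArg WithTop.some (sub_add_cancel (z.v j) (t.2.2.1 j)).symm
    have ha := hz
    rw [hback] at ha
    replace ha := (fire_le_fire_iff t (by rfl)).1 ha
    have hc : ∀ j, (((-(t.2.1 j)).toNat : ℤ) : WithTop ℤ) ≤ g.u j := by
      intro j
      have h1 := hf.2 j
      have h2 := hg.nonneg j
      rcases hgj : g.u j with _ | m
      · exact le_top
      · rw [hgj] at h1 h2
        have h1' : 0 ≤ m + t.2.1 j := WithTop.coe_le_coe.1 h1
        have h2' : 0 ≤ m := WithTop.coe_le_coe.1 h2
        refine WithTop.coe_le_coe.2 ?_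
        omega
    obtain ⟨x, hx, hcx, hax, -⟩ := hg.exists_between hc ha ha
    have hfx : Fireable t x.toExt := by
      refine ⟨hf.1.trans (q_eq_of_le hx).symm, fun j => ?_⟩
      have := hcx j
      change ((0 : ℤ) : WithTop ℤ) ≤ ((x.u j + t.2.1 j : ℤ) : WithTop ℤ)
      refine WithTop.coe_le_coe.2 ?_
      omega
    obtain ⟨y, hy⟩ := exists_toExt_eq_fire hfx
    refine ⟨y, x, hx, WeightedVASS.step_iff.2 ⟨t, ht, hfx, hy⟩, ?_⟩
    rw [← WConfig.toExt_le_toExt, hy, hback, fire_le_fire_iff t (q_eq_of_le hax)]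
    exact hax

end ExtConfig

/-! ### Weighted VASS are well behaved -/

namespace WeightedVASS

variable {Q : Type*} {d w : ℕ}

theorem toOrderedTS_monotone (V : WeightedVASS Q d w) : V.toOrderedTS.Monotone := by
  intro x x' y hstep hle
  obtain ⟨t, ht, hf, hy⟩ := step_iff.1 hstep
  have hle' := WConfig.toExt_le_toExt.2 hle
  obtain ⟨y', hy'⟩ := ExtConfig.exists_toExt_eq_fire (hf.mono hle')
  refine ⟨y', ?_, .single (step_iff.2 ⟨t, ht, hf.mono hle', hy'⟩)⟩
  refine WConfig.toExt_le_toExt.1 ?_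
  rw [hy, hy', ExtConfig.fire_le_fire_iff t hle'.1]
  exact hle'

/-- By Dickson's lemma an infinite set of configurations contains two with the same control state
and comparable counters; they are comparable, as the weights are linearly ordered. -/
theorem toOrderedTS_finiteAntichains [Finite Q] (V : WeightedVASS Q d w) :
    V.toOrderedTS.FiniteAntichains := by
  intro A hA
  by_contra hinf
  let f := Set.Infinite.natEmbedding A hinf
  let p : ℕ → WConfig Q d w := fun n => (f n : V.toOrderedTS.State)
  have hwqo : WellQuasiOrdered fun a b : Q × (Fin d → ℕ) => a.1 = b.1 ∧ a.2 ≤ b.2 :=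
    (Finite.wellQuasiOrdered (· = ·)).prod wellQuasiOrdered_le
  obtain ⟨m, n, hmn, hq, hu⟩ := hwqo fun n => ((p n).q, (p n).u)
  have hno : ∀ i j, i ≠ j → ¬ p i ≤ p j := fun i j hij =>
    hA (f i).2 (f j).2 fun h => hij (f.injective (Subtype.ext h))
  rcases lt_or_eq_of_le hu with hu | hu
  · exact hno m n hmn.ne ⟨hq, Or.inl hu⟩
  · rcases le_total (toLex (p m).v) (toLex (p n).v) with hv | hv
    · exact hno m n hmn.ne ⟨hq, Or.inr ⟨hu, hv⟩⟩
    · exact hno n m hmn.ne' ⟨hq.symm, Or.inr ⟨hu.symm, hv⟩⟩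

theorem toOrderedTS_isWBTS [Finite Q] (V : WeightedVASS Q d w) : V.toOrderedTS.IsWBTS :=
  ⟨V.toOrderedTS_monotone, V.toOrderedTS_finiteAntichains⟩

theorem not_isWSTS (V : WeightedVASS Q d w) (hQ : Nonempty Q) (hw : 0 < w) :
    ¬ V.toOrderedTS.IsWSTS := by
  rintro ⟨-, hwf, -⟩
  obtain ⟨q⟩ := hQ
  have : WellFoundedLT (WConfig Q d w) := hwf
  let f : ℕ → WConfig Q d w := fun n => ⟨q, 0, fun _ => -(n : ℤ)⟩
  have hf : StrictAnti f := by
    refine strictAnti_nat_of_succ_lt fun n => ?_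
    have hlt : toLex (f (n + 1)).v < toLex (f n).v := by
      refine ⟨⟨0, hw⟩, fun j hj => absurd hj (Nat.not_lt_zero _), ?_⟩
      change -((n + 1 : ℕ) : ℤ) < -(n : ℤ)
      omega
    refine lt_of_le_not_ge ⟨rfl, Or.inr ⟨rfl, hlt.le⟩⟩ ?_
    rintro ⟨-, h | h⟩
    · exact lt_irrefl _ h
    · exact absurd h.2 (not_le.2 hlt)
  exact not_strictAnti_of_wellFoundedLT f hf

end WeightedVASS

/-! ### Downward closed sets are finite unions of ideals -/

theorem WConfig.mk_le_mk_of_lt {Q : Type*} {d w : ℕ} {q : Q} {u u' : Fin d → ℕ}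
    {v v' : Fin w → ℤ} (h : u < u') : (⟨q, u, v⟩ : WConfig Q d w) ≤ ⟨q, u', v'⟩ :=
  ⟨rfl, Or.inl h⟩

theorem WConfig.mk_le_mk_of_toLex_le {Q : Type*} {d w : ℕ} {q : Q} {u : Fin d → ℕ}
    {v v' : Fin w → ℤ} (h : toLex v ≤ toLex v') : (⟨q, u, v⟩ : WConfig Q d w) ≤ ⟨q, u, v'⟩ :=
  ⟨rfl, Or.inr ⟨rfl, h⟩⟩

theorem toLex_cons_le_toLex_cons {w : ℕ} {α : Type*} [LinearOrder α] {a b : α} {x y : Fin w → α} :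
    toLex (Fin.cons a x : Fin (w + 1) → α) ≤ toLex (Fin.cons b y : Fin (w + 1) → α) ↔
      a < b ∨ (a = b ∧ toLex x ≤ toLex y) := by
  rw [← not_lt, ← not_lt (b := toLex x)]
  have : toLex (Fin.cons b y : Fin (w + 1) → α) < toLex (Fin.cons a x : Fin (w + 1) → α) ↔
      b < a ∨ (b = a ∧ toLex y < toLex x) :=
    Fin.pi_lex_lt_cons_cons (α := fun _ => α) (fun {_} => (· < ·))
  refine (not_congr this).trans ?_
  rcases lt_trichotomy a b with h | rfl | h
  · simp [h, h.not_gt, h.ne']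
  · simp only [lt_irrefl, false_or, true_and]
    exact Iff.rfl
  · simp [h, h.not_gt, h.ne']

/-- The nonempty downward closed sets of weights: either the first coordinate is unbounded, and
the set is everything, or it has a greatest value, above which the other coordinates form a
nonempty downward closed set again. -/
theorem exists_weight_bound {w : ℕ} (F : Set (Fin w → ℤ)) (hne : F.Nonempty)
    (hF : ∀ y ∈ F, ∀ x, toLex x ≤ toLex y → x ∈ F) :
    ∃ v : Fin w → WithTop ℤ, (∀ i j, i ≤ j → v i = ⊤ → v j = ⊤) ∧
      ∀ y : Fin w → ℤ, y ∈ F ↔ toLex (fun j => (y j : WithTop ℤ)) ≤ toLex v := by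
  induction w with
  | zero =>
    obtain ⟨x, hx⟩ := hne
    refine ⟨fun _ => ⊤, fun _ _ _ _ => rfl, fun y => ⟨fun _ => ?_, fun _ => ?_⟩⟩
    · exact Pi.toLex_monotone fun _ => le_top
    · rwa [Subsingleton.elim y x]
  | succ w ih =>
    have hcoe : ∀ (a : ℤ) (x : Fin w → ℤ),
        (fun j => ((Fin.cons a x : Fin (w + 1) → ℤ) j : WithTop ℤ)) =
          (Fin.cons (a : WithTop ℤ) fun j => (x j : WithTop ℤ) : Fin (w + 1) → WithTop ℤ) := by
      intro a x
      funext j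
      refine Fin.cases ?_ (fun j => ?_) j <;> rfl
    by_cases hb : ∃ b : ℤ, ∀ a : ℤ, (∃ x, (Fin.cons a x : Fin (w + 1) → ℤ) ∈ F) → a ≤ b
    · have hex : ∃ a : ℤ, ∃ x, (Fin.cons a x : Fin (w + 1) → ℤ) ∈ F := by
        obtain ⟨y, hy⟩ := hne
        exact ⟨y 0, Fin.tail y, by rwa [Fin.cons_self_tail]⟩
      obtain ⟨b, ⟨x₀, hx₀⟩, hmax⟩ := Int.exists_greatest_of_bdd hb hex
      obtain ⟨v, hv, hvF⟩ := ih {x | (Fin.cons b x : Fin (w + 1) → ℤ) ∈ F} ⟨x₀, hx₀⟩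
        fun y hy x hxy => hF _ hy _ (toLex_cons_le_toLex_cons.2 (Or.inr ⟨rfl, hxy⟩))
      refine ⟨Fin.cons (b : WithTop ℤ) v, fun i j hij => ?_, fun y => ?_⟩
      · cases i using Fin.cases with
        | zero => exact fun h => absurd h WithTop.coe_ne_top
        | succ i =>
          cases j using Fin.cases with
          | zero => exact absurd hij (Fin.succ_pos i).not_ge
          | succ j => simpa using hv i j (Fin.succ_le_succ_iff.1 hij)
      · rw [← Fin.cons_self_tail y, hcoe, toLex_cons_le_toLex_cons, WithTop.coe_lt_coe,
          WithTop.coe_inj, ← hvF]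
        constructor
        · intro hy
          rcases lt_or_eq_of_le (hmax _ ⟨_, hy⟩) with h | h
          · exact Or.inl h
          · exact Or.inr ⟨h, by rw [h] at hy; exact hy⟩
        · rintro (h | ⟨h, hy⟩)
          · exact hF _ hx₀ _ (toLex_cons_le_toLex_cons.2 (Or.inl h))
          · rw [h]; exact hy
    · push Not at hb
      refine ⟨fun _ => ⊤, fun _ _ _ _ => rfl, fun y => ⟨fun _ => ?_, fun _ => ?_⟩⟩
      · exact Pi.toLex_monotone fun _ => le_top
      · obtain ⟨a, ⟨x, hx⟩, ha⟩ := hb (y 0)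
        rw [← Fin.cons_self_tail y]
        exact hF _ hx _ (toLex_cons_le_toLex_cons.2 (Or.inl ha))

/-- A downward closed set of counter values is a finite union of boxes with possibly unbounded
sides: the maximal boxes contained in it are finitely many, because they form an antichain in a
well-quasi-ordering, and by Zorn's lemma every box contained in it lies in a maximal one. -/
theorem exists_counter_bounds_enat {d : ℕ} (U : Set (Fin d → ℕ)) :
    ∃ S : Set (Fin d → ℕ∞), S.Finite ∧
      (∀ m ∈ S, ∀ u : Fin d → ℕ, (∀ j, (u j : ℕ∞) ≤ m j) → u ∈ U) ∧
      ∀ u : Fin d → ℕ, (∀ u' ≤ u, u' ∈ U) → ∃ m ∈ S, ∀ j, (u j : ℕ∞) ≤ m j := by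
  let B : Set (Fin d → ℕ∞) := {m | ∀ u : Fin d → ℕ, (∀ j, (u j : ℕ∞) ≤ m j) → u ∈ U}
  refine ⟨{m | Maximal (· ∈ B) m}, ?_, fun m hm => hm.1, fun u hu => ?_⟩
  · exact WellQuasiOrderedLE.finite_of_isAntichain (setOfPred_maximal_antichain _)
  · have hchain : ∀ c ⊆ B, IsChain (· ≤ ·) c → ∀ y ∈ c, ∃ ub ∈ B, ∀ z ∈ c, z ≤ ub := by
      intro c hcB hc y hy
      refine ⟨sSup c, fun u hu => ?_, fun z hz => le_sSup hz⟩
      have hj : ∀ j, ∃ z : c, (u j : ℕ∞) ≤ (z : Fin d → ℕ∞) j := by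
        intro j
        rcases huj : u j with _ | k
        · exact ⟨⟨y, hy⟩, by simp⟩
        · have h1 : (k : ℕ∞) < sSup c j :=
            lt_of_lt_of_le (by rw [huj]; exact_mod_cast Nat.lt_succ_self k) (hu j)
          rw [sSup_apply, lt_iSup_iff] at h1
          obtain ⟨z, hz⟩ := h1
          refine ⟨z, ?_⟩
          rw [Nat.cast_succ]
          exact Order.add_one_le_of_lt hz
      choose z hz using hj
      have : Nonempty c := ⟨⟨y, hy⟩⟩
      obtain ⟨m, hm⟩ := (directedOn_iff_directed.1 hc.directedOn).finite_le z
      exact hcB m.2 u fun j => (hz j).trans (hm j j)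
    obtain ⟨m, hle, hm⟩ := zorn_le_nonempty₀ B hchain (fun j => (u j : ℕ∞))
      fun u' hu' => hu u' fun j => Nat.cast_le.1 (hu' j)
    exact ⟨m, hm, hle⟩

theorem exists_counter_bounds {d : ℕ} (U : Set (Fin d → ℕ)) (hU : IsLowerSet U) :
    ∃ S : Set (Fin d → WithTop ℤ), S.Finite ∧ (∀ m ∈ S, ∀ j, 0 ≤ m j) ∧
      ∀ u : Fin d → ℕ, u ∈ U ↔ ∃ m ∈ S, ∀ j, ((u j : ℤ) : WithTop ℤ) ≤ m j := by
  obtain ⟨S, hfin, h1, h2⟩ := exists_counter_bounds_enat U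
  let c : ℕ∞ → WithTop ℤ := WithTop.map fun n : ℕ => (n : ℤ)
  have hc : ∀ (k : ℕ) (m : ℕ∞), ((k : ℤ) : WithTop ℤ) ≤ c m ↔ (k : ℕ∞) ≤ m := by
    intro k m
    induction m using ENat.recTopCoe with
    | top => exact ⟨fun _ => le_top, fun _ => le_top⟩
    | coe m =>
      change ((k : ℤ) : WithTop ℤ) ≤ ((m : ℤ) : WithTop ℤ) ↔ _
      rw [WithTop.coe_le_coe, Nat.cast_le, Nat.cast_le]
  refine ⟨(fun m j => c (m j)) '' S, hfin.image _, ?_, fun u => ⟨fun hu => ?_, ?_⟩⟩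
  · rintro _ ⟨m, -, rfl⟩ j
    exact (hc 0 (m j)).2 (by simp)
  · obtain ⟨m, hm, hle⟩ := h2 u fun u' hu' => hU hu' hu
    exact ⟨_, ⟨m, hm, rfl⟩, fun j => (hc _ _).2 (hle j)⟩
  · rintro ⟨_, ⟨m, hm, rfl⟩, hle⟩
    exact h1 m hm u fun j => (hc _ _).1 (hle j)

namespace ExtConfig

variable {Q : Type*} {d w : ℕ}

/-- Inside a box of counter values that all occur in a downward closed set `D`, membership in `D` is
described by a single extended configuration: only the corner of the box, if finite, puts a
condition on the weight. -/
theorem exists_valid_of_box {D : Set (WConfig Q d w)} (hD : IsLowerSet D) (q : Q)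
    {m : Fin d → WithTop ℤ} (h0 : ∀ j, 0 ≤ m j)
    (hm : ∀ u : Fin d → ℕ, (∀ j, ((u j : ℤ) : WithTop ℤ) ≤ m j) →
      ∃ v, (⟨q, u, v⟩ : WConfig Q d w) ∈ D) :
    ∃ g : ExtConfig Q d w, g.Valid ∧ g.q = q ∧ g.u = m ∧
      ∀ x : WConfig Q d w, x.q = q → (∀ j, ((x.u j : ℤ) : WithTop ℤ) ≤ m j) →
        (x ∈ D ↔ x.toExt ≤ g) := by
  by_cases htop : ∃ i, m i = ⊤
  · obtain ⟨i, hi⟩ := htop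
    refine ⟨⟨q, m, fun _ => ⊤⟩, ⟨h0, fun _ _ _ _ => rfl, fun _ _ _ => rfl⟩, rfl, rfl, ?_⟩
    rintro ⟨q', u, v⟩ rfl hu
    refine iff_of_true ?_ ⟨rfl, Or.inl (Pi.lt_def.2 ⟨hu, i, ?_⟩)⟩
    · obtain ⟨v', hv'⟩ := hm (Function.update u i (u i + 1)) fun j => by
        by_cases hj : j = i
        · subst hj; rw [hi]; exact le_top
        · rw [Function.update_of_ne hj]; exact hu j
      exact hD (WConfig.mk_le_mk_of_lt (lt_update_self_iff.2 (Nat.lt_succ_self _))) hv'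
    · change ((u i : ℤ) : WithTop ℤ) < m i
      rw [hi]
      exact WithTop.coe_lt_top _
  · push Not at htop
    obtain ⟨u₀, rfl⟩ : ∃ u : Fin d → ℕ, m = fun j => ((u j : ℤ) : WithTop ℤ) := by
      refine ⟨fun j => ((m j).untop (htop j)).toNat, funext fun j => ?_⟩
      rw [Int.toNat_of_nonneg, WithTop.coe_untop]
      exact (WithTop.le_untop_iff _).2 (h0 j)
    obtain ⟨v₀, hv₀⟩ := hm u₀ fun j => le_rfl
    obtain ⟨v, hv, hvF⟩ := exists_weight_bound {v | (⟨q, u₀, v⟩ : WConfig Q d w) ∈ D} ⟨v₀, hv₀⟩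
      fun y hy x hxy => hD (WConfig.mk_le_mk_of_toLex_le hxy) hy
    refine ⟨⟨q, fun j => ((u₀ j : ℤ) : WithTop ℤ), v⟩,
      ⟨h0, hv, fun i hi => absurd hi WithTop.coe_ne_top⟩, rfl, rfl, ?_⟩
    rintro ⟨q', u, y⟩ rfl hu
    have hu' : u ≤ u₀ := fun j => Int.ofNat_le.1 (WithTop.coe_le_coe.1 (hu j))
    rcases lt_or_eq_of_le hu' with hlt | rfl
    · refine iff_of_true (hD (WConfig.mk_le_mk_of_lt hlt) hv₀) ⟨rfl, Or.inl ?_⟩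
      obtain ⟨-, j, hj⟩ := Pi.lt_def.1 hlt
      exact Pi.lt_def.2 ⟨hu, j, WithTop.coe_lt_coe.2 (Int.ofNat_lt.2 hj)⟩
    · rw [show (⟨q', u, y⟩ : WConfig Q d w) ∈ D ↔ _ from hvF y]
      refine ⟨fun h => ⟨rfl, Or.inr ⟨rfl, h⟩⟩, fun h => ?_⟩
      rcases h.2 with h | h
      · exact absurd h (lt_irrefl _)
      · exact h.2

/-- Every downward closed set of configurations is a finite union of ideals. -/
theorem exists_list_of_isLowerSet [Finite Q] {D : Set (WConfig Q d w)} (hD : IsLowerSet D) :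
    ∃ L : List (ExtConfig Q d w), (∀ g ∈ L, g.Valid) ∧
      ∀ x : WConfig Q d w, x ∈ D ↔ ∃ g ∈ L, x.toExt ≤ g := by
  have hU : ∀ q : Q, IsLowerSet {u : Fin d → ℕ | ∃ v, (⟨q, u, v⟩ : WConfig Q d w) ∈ D} := by
    rintro q u u' hle ⟨v, hv⟩
    rcases lt_or_eq_of_le hle with h | rfl
    · exact ⟨v, hD (WConfig.mk_le_mk_of_lt h) hv⟩
    · exact ⟨v, hv⟩
  choose S hfin h0 hS using fun q => exists_counter_bounds _ (hU q)
  have key : ∀ p : Q × (Fin d → WithTop ℤ), ∃ g : ExtConfig Q d w, p.2 ∈ S p.1 →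
      g.Valid ∧ g.q = p.1 ∧ g.u = p.2 ∧
      ∀ x : WConfig Q d w, x.q = p.1 → (∀ j, ((x.u j : ℤ) : WithTop ℤ) ≤ p.2 j) →
        (x ∈ D ↔ x.toExt ≤ g) := by
    rintro ⟨q, m⟩
    by_cases hm : m ∈ S q
    · obtain ⟨g, hg⟩ := exists_valid_of_box hD q (h0 q m hm) fun u hu => (hS q u).2 ⟨m, hm, hu⟩
      exact ⟨g, fun _ => hg⟩
    · exact ⟨⟨q, m, fun _ => ⊤⟩, fun h => absurd h hm⟩
  choose G hG using key
  have hGfin : (⋃ q, (fun m => G (q, m)) '' S q).Finite :=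
    Set.finite_iUnion fun q => (hfin q).image _
  refine ⟨hGfin.toFinset.toList, fun g hg => ?_, fun x => ?_⟩
  · simp only [Finset.mem_toList, Set.Finite.mem_toFinset, Set.mem_iUnion, Set.mem_image] at hg
    obtain ⟨q, m, hm, rfl⟩ := hg
    exact (hG (q, m) hm).1
  · simp only [Finset.mem_toList, Set.Finite.mem_toFinset, Set.mem_iUnion, Set.mem_image]
    constructor
    · intro hx
      obtain ⟨m, hm, hle⟩ := (hS x.q x.u).1 ⟨x.v, hx⟩
      exact ⟨_, ⟨x.q, m, hm, rfl⟩, ((hG (x.q, m) hm).2.2.2 x rfl hle).1 hx⟩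
    · rintro ⟨_, ⟨q, m, hm, rfl⟩, hle⟩
      obtain ⟨-, hq, hu, h⟩ := hG (q, m) hm
      refine (h x (hle.1.trans hq) fun j => ?_).2 hle
      have := u_le_of_le hle j
      rw [hu] at this
      exact this

/-- Every ideal of configurations is given by a valid extended configuration: it is a finite
union of such ideals, hence one of them. -/
theorem exists_valid_of_ideal [Finite Q] (I : Order.Ideal (WConfig Q d w)) :
    ∃ g : ExtConfig Q d w, ∃ hg : g.Valid, hg.ideal = I := by
  obtain ⟨L, hL, h⟩ := exists_list_of_isLowerSet I.lower
  obtain ⟨g, hg, hle⟩ := exists_forall_le_of_ideal I L fun x hx => (h x).1 hx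
  refine ⟨g, hL g hg, ?_⟩
  ext x
  exact ⟨fun hx => (h x).2 ⟨g, hg, hx⟩, fun hx => hle x hx⟩

end ExtConfig

/-! ### Certificates of non-coverability -/

namespace WeightedVASS

open ExtConfig

variable {Q : Type*} {d w : ℕ}

/-- A finite union of ideals that contains `x`, does not contain `y`, and is closed under taking
successors, where inclusion of an ideal in the union is inclusion in one of its members. -/
structure IsSeparating (V : WeightedVASS Q d w) (x y : ExtConfig Q d w)
    (L : List (ExtConfig Q d w)) : Prop where
  valid : ∀ g ∈ L, g.Valid
  le_of_mem : ∃ g ∈ L, x ≤ g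
  not_le_of_mem : ∀ g ∈ L, ¬ y ≤ g
  closed : ∀ g ∈ L, ∀ t ∈ V.T, Fireable t g → ∃ g' ∈ L, fire t g ≤ g'

/-- The set of configurations coverable from `x` is downward closed and closed under steps, hence
a finite union of ideals that certifies which configurations are not coverable. -/
theorem not_coverable_iff [Finite Q] (V : WeightedVASS Q d w) (x y : WConfig Q d w) :
    ¬ V.toOrderedTS.Coverable x y ↔ ∃ L, V.IsSeparating x.toExt y.toExt L := by
  constructor
  · intro hno
    let D : Set (WConfig Q d w) := {z | V.toOrderedTS.Coverable x z}
    have hD : IsLowerSet D := by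
      rintro a b hba ⟨a', ha', haa'⟩
      exact ⟨a', ha', hba.trans haa'⟩
    obtain ⟨L, hL, hLD⟩ := exists_list_of_isLowerSet hD
    refine ⟨L, hL, (hLD x).1 ⟨x, .refl, le_rfl⟩, fun g hg hle => hno ((hLD y).2 ⟨g, hg, hle⟩), ?_⟩
    intro g hg t ht hf
    refine ((hL g hg).valid_fire hf).exists_le_of_forall_exists_le hL fun z hz => (hLD z).1 ?_
    obtain ⟨b, a, ha, hstep, hzb⟩ :=
      ((hL g hg).mem_lowerClosure_postSet_iff V z).2 ⟨t, ht, hf, hz⟩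
    obtain ⟨a', hxa', haa'⟩ := (hLD a).2 ⟨g, hg, ha⟩
    obtain ⟨b', hbb', hab'⟩ := V.toOrderedTS_monotone a a' b hstep haa'
    exact ⟨b', hxa'.trans hab', le_trans hzb hbb'⟩
  · rintro ⟨L, hL⟩ ⟨y', hxy', hyy'⟩
    have hinv : ∀ z : WConfig Q d w, V.toOrderedTS.steps x z → ∃ g ∈ L, z.toExt ≤ g := by
      intro z hz
      induction hz with
      | refl => exact hL.le_of_mem
      | tail _ hstep ih =>
        obtain ⟨g, hg, hle⟩ := ih
        obtain ⟨t, ht, hf, heq⟩ := step_iff.1 hstep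
        obtain ⟨g', hg', hle'⟩ := hL.closed g hg t ht (hf.mono hle)
        refine ⟨g', hg', le_trans ?_ hle'⟩
        rw [heq, fire_le_fire_iff t hle.1]
        exact hle
    obtain ⟨g, hg, hle⟩ := hinv y' hxy'
    exact hL.not_le_of_mem g hg ((WConfig.toExt_le_toExt.2 hyy').trans hle)

end WeightedVASS

/-! ### Primitive recursive integer arithmetic -/

namespace Primrec

/-- Natural numbers are encoded in `ℤ` as the even numbers, negative numbers as the odd ones. -/
theorem int_natCast : Primrec fun n : ℕ => (n : ℤ) :=
  Primrec.encode_iff.1 (nat_double.of_eq fun _ => rfl)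

theorem int_negSucc : Primrec Int.negSucc :=
  Primrec.encode_iff.1 (nat_double_succ.of_eq fun _ => rfl)

theorem int_toNat : Primrec Int.toNat := by
  refine (Primrec.cond (nat_bodd.comp Primrec.encode) (Primrec.const 0)
    (nat_div2.comp Primrec.encode)).of_eq fun z => ?_
  rcases z with n | n
  · change (bif Nat.bodd (2 * n) then 0 else Nat.div2 (2 * n)) = n
    simp [Nat.div2_val]
  · change (bif Nat.bodd (2 * n + 1) then 0 else Nat.div2 (2 * n + 1)) = 0
    simp

theorem int_neg_toNat : Primrec fun z : ℤ => (-z).toNat := by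
  refine (Primrec.cond (nat_bodd.comp Primrec.encode)
    (Primrec.succ.comp (nat_div2.comp Primrec.encode)) (Primrec.const 0)).of_eq fun z => ?_
  rcases z with n | n
  · change (bif Nat.bodd (2 * n) then Nat.succ (Nat.div2 (2 * n)) else 0) = (-(n : ℤ)).toNat
    simp
  · change (bif Nat.bodd (2 * n + 1) then Nat.succ (Nat.div2 (2 * n + 1)) else 0) = n + 1
    simp [Nat.div2_val]

theorem int_natCast_sub : Primrec₂ fun m n : ℕ => (m : ℤ) - n := by
  refine (Primrec.ite (nat_le.comp snd fst) (int_natCast.comp (nat_sub.comp fst snd))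
    (int_negSucc.comp (Primrec.pred.comp (nat_sub.comp snd fst)))).of_eq fun p => ?_
  change _ = (p.1 : ℤ) - p.2
  split_ifs with h
  · omega
  · rw [Int.negSucc_eq, Nat.pred_eq_sub_one]
    omega

theorem int_add : Primrec₂ fun a b : ℤ => a + b := by
  refine (int_natCast_sub.comp
    (nat_add.comp (int_toNat.comp fst) (int_toNat.comp snd))
    (nat_add.comp (int_neg_toNat.comp fst) (int_neg_toNat.comp snd))).of_eq fun p => ?_
  push_cast
  omega

theorem int_le : PrimrecRel fun a b : ℤ => a ≤ b := by
  refine PrimrecPred.of_eq (nat_le.comp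
    (nat_add.comp (int_toNat.comp fst) (int_neg_toNat.comp snd))
    (nat_add.comp (int_toNat.comp snd) (int_neg_toNat.comp fst))) fun p => ?_
  omega

end Primrec

/-- Integers with a top element are encoded as optional integers. -/
instance WithTop.instPrimcodableInt : Primcodable (WithTop ℤ) :=
  inferInstanceAs (Primcodable (Option ℤ))

namespace Primrec

theorem withTop_coe : Primrec fun z : ℤ => (z : WithTop ℤ) :=
  (Primrec.option_some : Primrec (@Option.some ℤ))

theorem withTop_add_coe : Primrec₂ fun (a : WithTop ℤ) (z : ℤ) => a + (z : WithTop ℤ) := by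
  have h : Primrec₂ fun (a : Option ℤ) (z : ℤ) => a.map (· + z) :=
    Primrec.option_map fst (int_add.comp snd (snd.comp fst))
  refine Primrec₂.of_eq (f := fun (a : WithTop ℤ) (z : ℤ) => (Option.map (· + z) a : Option ℤ)) h
    fun a z => ?_
  rcases a with _ | a <;> rfl

theorem withTop_le : PrimrecRel fun a b : WithTop ℤ => a ≤ b := by
  have h : Primrec fun a : Option ℤ => a.getD 0 :=
    Primrec.option_getD.comp Primrec.id (Primrec.const 0)
  have hD : Primrec fun a : WithTop ℤ => a.untopD 0 :=
    Primrec.of_eq (f := fun a : WithTop ℤ => Option.getD a 0) h fun a => by cases a <;> rfl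
  refine PrimrecPred.of_eq (.or (Primrec.eq.comp snd (Primrec.const ⊤))
    (.and (.not (Primrec.eq.comp fst (Primrec.const ⊤)))
      (int_le.comp (hD.comp fst) (hD.comp snd)))) ?_
  rintro ⟨a, b⟩
  induction a <;> induction b <;> simp

theorem withTop_lt : PrimrecRel fun a b : WithTop ℤ => a < b :=
  PrimrecPred.of_eq (withTop_le.comp snd fst).not fun _ => not_le

end Primrec

/-! ### Decision procedures on codes -/

section Quantifiers

variable {α β : Type*} [Primcodable α] [Primcodable β]

theorem PrimrecPred.forall_mem_of_primrec {f : α → List β} {P : α → β → Prop} (hf : Primrec f)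
    (hP : PrimrecPred fun p : α × β => P p.1 p.2) : PrimrecPred fun a => ∀ b ∈ f a, P a b :=
  (PrimrecRel.forall_mem_list (R := fun b a => P a b) (hP.comp (Primrec.snd.pair Primrec.fst))).comp
    hf Primrec.id

theorem PrimrecPred.exists_mem_of_primrec {f : α → List β} {P : α → β → Prop} (hf : Primrec f)
    (hP : PrimrecPred fun p : α × β => P p.1 p.2) : PrimrecPred fun a => ∃ b ∈ f a, P a b :=
  (PrimrecRel.exists_mem_list (R := fun b a => P a b) (hP.comp (Primrec.snd.pair Primrec.fst))).comp
    hf Primrec.id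

theorem PrimrecPred.imp {p q : α → Prop} (hp : PrimrecPred p) (hq : PrimrecPred q) :
    PrimrecPred fun a => p a → q a :=
  PrimrecPred.of_eq (hp.not.or hq) fun _ => imp_iff_not_or.symm

theorem REPred.exists_nat {P : α → ℕ → Prop} (h : PrimrecPred fun p : α × ℕ => P p.1 p.2) :
    REPred fun a => ∃ n, P a n := by
  classical
  have hr : Partrec fun a => Nat.rfind fun n => Part.some (decide (P a n)) :=
    Partrec.rfind (h.decide.to_comp.partrec.to₂)
  refine hr.dom_re.of_eq fun a => ?_
  refine Nat.rfind_dom.trans ?_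
  constructor
  · rintro ⟨n, hn, -⟩
    exact ⟨n, of_decide_eq_true (Part.mem_some_iff.1 hn).symm⟩
  · rintro ⟨n, hn⟩
    exact ⟨n, Part.mem_some_iff.2 (decide_eq_true hn).symm, fun _ => trivial⟩

theorem ComputablePred.exists_partrec {P : α → Prop} (h : ComputablePred P) :
    ∃ M : α →. Bool, Partrec M ∧ ∀ a, ∃ b ∈ M a, (b = true ↔ P a) := by
  obtain ⟨f, hf, rfl⟩ := ComputablePred.computable_iff.1 h
  exact ⟨_, hf.partrec, fun a => ⟨f a, Part.mem_some _, Iff.rfl⟩⟩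

end Quantifiers

/-- Repetitions can be removed from a list by a primitive recursive function. -/
theorem Primrec.exists_dedup {α : Type*} [Primcodable α] :
    ∃ f : List α → List α, Primrec f ∧ ∀ l, (f l).Nodup ∧ ∀ a, a ∈ f l ↔ a ∈ l := by
  classical
  let step : α → List α → List α := fun a l => if ∃ b ∈ l, b = a then l else a :: l
  have hstep : Primrec₂ step := by
    refine Primrec.ite ?_ snd (list_cons.comp fst snd)
    exact PrimrecPred.exists_mem_of_primrec snd (Primrec.eq.comp snd (fst.comp fst))
  refine ⟨fun l => l.foldr step [], ?_, fun l => ?_⟩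
  · exact Primrec.list_foldr Primrec.id (Primrec.const [])
      (hstep.comp (fst.comp snd) (snd.comp snd)).to₂
  · induction l with
    | nil => simp
    | cons a l ih =>
      obtain ⟨h1, h2⟩ := ih
      dsimp only at h1 h2
      simp only [List.foldr_cons]
      generalize l.foldr step [] = m at h1 h2
      by_cases h : ∃ b ∈ m, b = a
      · simp only [step, if_pos h]
        obtain ⟨b, hb, rfl⟩ := h
        refine ⟨h1, fun c => ?_⟩
        rw [List.mem_cons, ← h2]
        exact ⟨Or.inr, fun h => h.elim (fun h => h ▸ hb) id⟩
      · simp only [step, if_neg h]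
        refine ⟨List.nodup_cons.2 ⟨fun ha => h ⟨a, ha, rfl⟩, h1⟩, fun c => ?_⟩
        rw [List.mem_cons, List.mem_cons, h2]

/-- The data `(d, w, n, L)` describing a weighted VASS. -/
abbrev VASSData : Type := ℕ × ℕ × ℕ × List (ℕ × List ℤ × List ℤ × ℕ)

/-- Extended configurations written with numbers and lists, for any set of control states and any
dimensions. -/
abbrev RawConfig : Type := ℕ × List (WithTop ℤ) × List (WithTop ℤ)

theorem List.getD_ofFn_val {α : Type*} {n : ℕ} (f : Fin n → α) (i : Fin n) (a : α) :
    (List.ofFn f).getD i a = f i := by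
  simp [List.getD_eq_getElem?_getD]

theorem List.forall_mem_range_ofFn {α : Type*} {n : ℕ} (f : Fin n → α) {P : ℕ → Prop} :
    (∀ k ∈ List.range (List.ofFn f).length, P k) ↔ ∀ i : Fin n, P i := by
  simp [Fin.forall_iff]

theorem List.exists_mem_range_ofFn {α : Type*} {n : ℕ} (f : Fin n → α) {P : ℕ → Prop} :
    (∃ k ∈ List.range (List.ofFn f).length, P k) ↔ ∃ i : Fin n, P i := by
  simp [Fin.exists_iff]

namespace ExtConfig

variable {n d w : ℕ}

/-- An extended configuration written with numbers and lists. -/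
def toRaw (g : ExtConfig (Fin n) d w) : RawConfig := (g.q.val, List.ofFn g.u, List.ofFn g.v)

theorem toRaw_injective : Function.Injective (toRaw (n := n) (d := d) (w := w)) := by
  intro g g' h
  simp only [toRaw, Prod.mk.injEq] at h
  exact ExtConfig.ext (Fin.ext h.1) (List.ofFn_injective h.2.1) (List.ofFn_injective h.2.2)

theorem exists_toRaw_eq_iff {r : RawConfig} :
    (∃ g : ExtConfig (Fin n) d w, g.toRaw = r) ↔ r.1 < n ∧ r.2.1.length = d ∧ r.2.2.length = w := by
  constructor
  · rintro ⟨g, rfl⟩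
    simp [toRaw]
  · obtain ⟨q, u, v⟩ := r
    rintro ⟨hq, rfl, rfl⟩
    exact ⟨⟨⟨q, hq⟩, u.get, v.get⟩, by simp [toRaw]⟩

end ExtConfig

namespace RawConfig

open ExtConfig Primrec

/-- The ordering of extended configurations, on lists. -/
def LE (r s : RawConfig) : Prop :=
  r.1 = s.1 ∧ (∀ k ∈ List.range r.2.1.length, r.2.1.getD k ⊤ ≤ s.2.1.getD k ⊤) ∧
    (r.2.1 = s.2.1 → r.2.2 = s.2.2 ∨ ∃ k ∈ List.range r.2.2.length,
      (∀ l ∈ List.range k, r.2.2.getD l ⊤ = s.2.2.getD l ⊤) ∧ r.2.2.getD k ⊤ < s.2.2.getD k ⊤)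

theorem toRaw_le_iff {n d w : ℕ} {g g' : ExtConfig (Fin n) d w} :
    LE g.toRaw g'.toRaw ↔ g ≤ g' := by
  have hlex : toLex g.v ≤ toLex g'.v ↔ List.ofFn g.v = List.ofFn g'.v ∨
      ∃ k ∈ List.range (List.ofFn g.v).length,
        (∀ l ∈ List.range k, (List.ofFn g.v).getD l ⊤ = (List.ofFn g'.v).getD l ⊤) ∧
          (List.ofFn g.v).getD k ⊤ < (List.ofFn g'.v).getD k ⊤ := by
    rw [le_iff_eq_or_lt, List.exists_mem_range_ofFn, List.ofFn_inj]
    refine or_congr toLex_inj ?_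
    change (∃ i, (∀ j < i, g.v j = g'.v j) ∧ g.v i < g'.v i) ↔ _
    refine exists_congr fun i => ?_
    rw [List.getD_ofFn_val, List.getD_ofFn_val]
    refine and_congr_left fun _ => ⟨fun h l hl => ?_, fun h j hj => ?_⟩
    · have hl' := List.mem_range.1 hl
      have := h ⟨l, hl'.trans i.2⟩ hl'
      rw [← List.getD_ofFn_val g.v ⟨l, hl'.trans i.2⟩ ⊤,
        ← List.getD_ofFn_val g'.v ⟨l, hl'.trans i.2⟩ ⊤] at this
      exact this
    · have := h j (List.mem_range.2 hj)
      rwa [List.getD_ofFn_val, List.getD_ofFn_val] at this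
  have hu : (∀ k ∈ List.range (List.ofFn g.u).length,
      (List.ofFn g.u).getD k ⊤ ≤ (List.ofFn g'.u).getD k ⊤) ↔ g.u ≤ g'.u := by
    rw [List.forall_mem_range_ofFn]
    simp only [List.getD_ofFn_val]
    rfl
  simp only [LE, toRaw]
  rw [hu, ← hlex, Fin.val_inj, List.ofFn_inj, le_def]
  refine and_congr_right fun _ => ⟨fun h => ?_, fun h => ?_⟩
  · rcases lt_or_eq_of_le h.1 with h' | h'
    · exact Or.inl h'
    · exact Or.inr ⟨h', h.2 h'⟩
  · rcases h with h | h
    · exact ⟨h.le, fun h' => absurd h' h.ne⟩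
    · exact ⟨h.1.le, fun _ => h.2⟩

theorem primrecRel_le : PrimrecRel LE := by
  have hu₁ : Primrec fun p : RawConfig × RawConfig => p.1.2.1 := fst.comp (snd.comp fst)
  have hu₂ : Primrec fun p : RawConfig × RawConfig => p.2.2.1 := fst.comp (snd.comp snd)
  have hv₁ : Primrec fun p : RawConfig × RawConfig => p.1.2.2 := snd.comp (snd.comp fst)
  have hv₂ : Primrec fun p : RawConfig × RawConfig => p.2.2.2 := snd.comp (snd.comp snd)
  refine .and (Primrec.eq.comp (fst.comp fst) (fst.comp snd)) (.and ?_ (.imp ?_ (.or ?_ ?_)))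
  · exact .forall_mem_of_primrec (list_range.comp (list_length.comp hu₁))
      (withTop_le.comp ((list_getD ⊤).comp (hu₁.comp fst) snd)
        ((list_getD ⊤).comp (hu₂.comp fst) snd))
  · exact Primrec.eq.comp hu₁ hu₂
  · exact Primrec.eq.comp hv₁ hv₂
  · refine .exists_mem_of_primrec (list_range.comp (list_length.comp hv₁)) (.and ?_ ?_)
    · exact .forall_mem_of_primrec (list_range.comp snd)
        (Primrec.eq.comp ((list_getD ⊤).comp (hv₁.comp (fst.comp fst)) snd)
          ((list_getD ⊤).comp (hv₂.comp (fst.comp fst)) snd))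
    · exact withTop_lt.comp ((list_getD ⊤).comp (hv₁.comp fst) snd)
        ((list_getD ⊤).comp (hv₂.comp fst) snd)

/-- Whether the lists describe a valid extended configuration of the given VASS. -/
def Valid (D : VASSData) (r : RawConfig) : Prop :=
  (r.1 < D.2.2.1 ∧ r.2.1.length = D.1 ∧ r.2.2.length = D.2.1) ∧
    (∀ a ∈ r.2.1, 0 ≤ a) ∧
    (∀ k ∈ List.range r.2.2.length, r.2.2.getD k ⊤ = ⊤ →
      ∀ l ∈ List.range r.2.2.length, k ≤ l → r.2.2.getD l ⊤ = ⊤) ∧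
    (∀ a ∈ r.2.1, a = ⊤ → ∀ b ∈ r.2.2, b = ⊤)

theorem valid_iff {D : VASSData} {r : RawConfig} :
    Valid D r ↔ ∃ g : ExtConfig (Fin D.2.2.1) D.1 D.2.1, g.Valid ∧ g.toRaw = r := by
  have key : ∀ g : ExtConfig (Fin D.2.2.1) D.1 D.2.1, Valid D g.toRaw ↔ g.Valid := by
    intro g
    have h := exists_toRaw_eq_iff.1 ⟨g, rfl⟩
    simp only [toRaw] at h
    simp only [Valid, toRaw]
    rw [and_iff_right h, List.forall_mem_range_ofFn]
    simp only [List.forall_mem_range_ofFn, List.getD_ofFn_val, List.forall_mem_ofFn_iff]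
    exact ⟨fun h => ⟨h.1, fun i j hij hi => h.2.1 i hi j hij, h.2.2⟩,
      fun h => ⟨h.1, fun i hi j hij => h.2 i j hij hi, h.3⟩⟩
  constructor
  · intro h
    obtain ⟨g, rfl⟩ := exists_toRaw_eq_iff.2 h.1
    exact ⟨g, (key g).1 h, rfl⟩
  · rintro ⟨g, hg, rfl⟩
    exact (key g).2 hg

theorem primrecRel_valid : PrimrecRel Valid := by
  have hu : Primrec fun p : VASSData × RawConfig => p.2.2.1 := fst.comp (snd.comp snd)
  have hv : Primrec fun p : VASSData × RawConfig => p.2.2.2 := snd.comp (snd.comp snd)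
  refine .and (.and ?_ (.and ?_ ?_)) (.and ?_ (.and ?_ ?_))
  · exact nat_lt.comp (fst.comp snd) (fst.comp (snd.comp (snd.comp fst)))
  · exact Primrec.eq.comp (list_length.comp hu) (fst.comp fst)
  · exact Primrec.eq.comp (list_length.comp hv) (fst.comp (snd.comp fst))
  · exact .forall_mem_of_primrec hu (withTop_le.comp (Primrec.const 0) snd)
  · refine .forall_mem_of_primrec (list_range.comp (list_length.comp hv)) (.imp ?_ ?_)
    · exact Primrec.eq.comp ((list_getD ⊤).comp (hv.comp fst) snd) (Primrec.const ⊤)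
    · refine .forall_mem_of_primrec (list_range.comp (list_length.comp (hv.comp fst))) (.imp ?_ ?_)
      · exact nat_le.comp (snd.comp fst) snd
      · exact Primrec.eq.comp ((list_getD ⊤).comp (hv.comp (fst.comp fst)) snd) (Primrec.const ⊤)
  · refine .forall_mem_of_primrec hu (.imp (Primrec.eq.comp snd (Primrec.const ⊤)) ?_)
    exact .forall_mem_of_primrec (hv.comp fst) (Primrec.eq.comp snd (Primrec.const ⊤))

/-- Coordinatewise addition. -/
def addList (a : List (WithTop ℤ)) (z : List ℤ) : List (WithTop ℤ) :=
  (List.range a.length).map fun k => a.getD k ⊤ + ((z.getD k 0 : ℤ) : WithTop ℤ)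

theorem addList_ofFn {n : ℕ} (f : Fin n → WithTop ℤ) (z : Fin n → ℤ) :
    addList (List.ofFn f) (List.ofFn z) = List.ofFn fun j => f j + (z j : WithTop ℤ) := by
  refine List.ext_getElem (by simp [addList]) fun k h₁ h₂ => ?_
  rw [List.length_ofFn] at h₂
  simp [addList, List.getD_eq_getElem?_getD, h₂]

theorem primrec_addList : Primrec₂ addList := by
  refine list_map (list_range.comp (list_length.comp fst)) ?_
  exact withTop_add_coe.comp ((list_getD ⊤).comp (fst.comp fst) snd)
    ((list_getD 0).comp (snd.comp fst) snd)

/-- Whether `s` describes a transition of the VASS that may be fired at `r`. -/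
def Fireable (D : VASSData) (r : RawConfig) (s : ℕ × List ℤ × List ℤ × ℕ) : Prop :=
  s.1 = r.1 ∧ s.1 < D.2.2.1 ∧ s.2.2.2 < D.2.2.1 ∧ s.2.1.length = D.1 ∧ s.2.2.1.length = D.2.1 ∧
    ∀ k ∈ List.range r.2.1.length, 0 ≤ r.2.1.getD k ⊤ + ((s.2.1.getD k 0 : ℤ) : WithTop ℤ)

open Classical in
/-- All results of firing a transition. -/
noncomputable def post (D : VASSData) (r : RawConfig) : List RawConfig :=
  D.2.2.2.filterMap fun s =>
    if Fireable D r s then some (s.2.2.2, addList r.2.1 s.2.1, addList r.2.2 s.2.2.1) else none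

theorem mem_post_iff {D : VASSData} {g : ExtConfig (Fin D.2.2.1) D.1 D.2.1} {s : RawConfig} :
    s ∈ post D g.toRaw ↔
      ∃ t ∈ (StdVASS.ofData D).V.T, ExtConfig.Fireable t g ∧ (fire t g).toRaw = s := by
  have hT : ∀ t : Fin D.2.2.1 × (Fin D.1 → ℤ) × (Fin D.2.1 → ℤ) × Fin D.2.2.1,
      t ∈ (StdVASS.ofData D).V.T ↔ transData t ∈ D.2.2.2 := fun t => by
    change t ∈ Set.Finite.toFinset _ ↔ _
    rw [Set.Finite.mem_toFinset]
    rfl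
  have hf : ∀ t : Fin D.2.2.1 × (Fin D.1 → ℤ) × (Fin D.2.1 → ℤ) × Fin D.2.2.1,
      Fireable D g.toRaw (transData t) ↔ ExtConfig.Fireable t g := fun t => by
    simp only [Fireable, toRaw, transData]
    rw [List.forall_mem_range_ofFn]
    simp only [List.getD_ofFn_val, List.length_ofFn, Fin.val_inj, Fin.is_lt, true_and]
    rfl
  have hr : ∀ t : Fin D.2.2.1 × (Fin D.1 → ℤ) × (Fin D.2.1 → ℤ) × Fin D.2.2.1,
      ((transData t).2.2.2, addList g.toRaw.2.1 (transData t).2.1,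
        addList g.toRaw.2.2 (transData t).2.2.1) = (fire t g).toRaw := fun t => by
    simp only [toRaw, transData, addList_ofFn, fire]
  simp only [post, List.mem_filterMap, Option.ite_none_right_eq_some, Option.some.injEq]
  constructor
  · rintro ⟨⟨p, z, y, q⟩, hmem, hfire, rfl⟩
    obtain ⟨t, ht⟩ : ∃ t : Fin D.2.2.1 × (Fin D.1 → ℤ) × (Fin D.2.1 → ℤ) × Fin D.2.2.1,
        transData t = (p, z, y, q) := by
      obtain ⟨-, hp, hq, hz, hy, -⟩ := hfire
      simp only at hp hq hz hy
      refine ⟨(⟨p, hp⟩, fun j => z.get (j.cast hz.symm), fun j => y.get (j.cast hy.symm),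
        ⟨q, hq⟩), ?_⟩
      simp only [transData, Prod.mk.injEq, true_and, and_true]
      exact ⟨List.ext_getElem (by simp [hz]) (by simp), List.ext_getElem (by simp [hy]) (by simp)⟩
    rw [← ht] at hmem hfire ⊢
    exact ⟨t, (hT t).2 hmem, (hf t).1 hfire, (hr t).symm⟩
  · rintro ⟨t, ht, hfire, rfl⟩
    exact ⟨transData t, (hT t).1 ht, (hf t).2 hfire, hr t⟩

theorem primrec_post : Primrec₂ post := by
  classical
  refine listFilterMap (snd.comp (snd.comp (snd.comp fst))) (Primrec.ite ?_ ?_ (Primrec.const none))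
  · have hD : Primrec fun p : (VASSData × RawConfig) × (ℕ × List ℤ × List ℤ × ℕ) => p.1.1 :=
      fst.comp fst
    have hn : Primrec fun p : (VASSData × RawConfig) × (ℕ × List ℤ × List ℤ × ℕ) => p.1.1.2.2.1 :=
      fst.comp (snd.comp (snd.comp hD))
    have hr : Primrec fun p : (VASSData × RawConfig) × (ℕ × List ℤ × List ℤ × ℕ) => p.1.2 :=
      snd.comp fst
    refine .and ?_ (.and ?_ (.and ?_ (.and ?_ (.and ?_ ?_))))
    · exact Primrec.eq.comp (fst.comp snd) (fst.comp hr)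
    · exact nat_lt.comp (fst.comp snd) hn
    · exact nat_lt.comp (snd.comp (snd.comp (snd.comp snd))) hn
    · exact Primrec.eq.comp (list_length.comp (fst.comp (snd.comp snd))) (fst.comp hD)
    · exact Primrec.eq.comp (list_length.comp (fst.comp (snd.comp (snd.comp snd))))
        (fst.comp (snd.comp hD))
    · refine .forall_mem_of_primrec (list_range.comp (list_length.comp (fst.comp (snd.comp hr)))) ?_
      refine withTop_le.comp (Primrec.const 0) (withTop_add_coe.comp ?_ ?_)
      · exact (list_getD ⊤).comp (fst.comp (snd.comp (hr.comp fst))) snd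
      · exact (list_getD 0).comp (fst.comp (snd.comp (snd.comp fst))) snd
  · refine option_some.comp (.pair (snd.comp (snd.comp (snd.comp snd))) (.pair ?_ ?_))
    · exact primrec_addList.comp (fst.comp (snd.comp (snd.comp fst))) (fst.comp (snd.comp snd))
    · exact primrec_addList.comp (snd.comp (snd.comp (snd.comp fst)))
        (fst.comp (snd.comp (snd.comp snd)))

/-- The lists describing the configuration encoded by a number. -/
def ofCode (e : ℕ) : RawConfig :=
  let r : ℕ × List ℕ × List ℤ := Denumerable.ofNat _ e
  (r.1, r.2.1.map fun k : ℕ => ((k : ℤ) : WithTop ℤ), r.2.2.map fun z : ℤ => (z : WithTop ℤ))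

theorem primrec_ofCode : Primrec ofCode := by
  have h : Primrec fun e => (Denumerable.ofNat (ℕ × List ℕ × List ℤ) e) := Primrec.ofNat _
  refine .pair (fst.comp h) (.pair ?_ ?_)
  · exact list_map (fst.comp (snd.comp h)) (withTop_coe.comp (int_natCast.comp snd))
  · exact list_map (snd.comp (snd.comp h)) (withTop_coe.comp snd)

theorem ofCode_eq_toRaw {n d w e : ℕ} {x : WConfig (Fin n) d w}
    (h : WConfig.ofCode n d w e = some x) : ofCode e = x.toExt.toRaw := by
  rw [WConfig.ofCode] at h
  split_ifs at h with hr
  obtain ⟨-, rfl, rfl⟩ := id hr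
  rw [Option.some.injEq] at h
  subst h
  simp only [ofCode, toRaw, WConfig.toExt, ofInt, Prod.mk.injEq, true_and]
  exact ⟨List.ext_getElem (by simp) (by simp), List.ext_getElem (by simp) (by simp)⟩

theorem isSome_ofCode_iff {n d w e : ℕ} : (WConfig.ofCode n d w e).isSome = true ↔
    (ofCode e).1 < n ∧ (ofCode e).2.1.length = d ∧ (ofCode e).2.2.length = w := by
  rw [WConfig.ofCode]
  simp only [ofCode, List.length_map]
  split_ifs with h
  · simpa using h
  · simpa using h

end RawConfig

namespace RawConfig

open ExtConfig Primrec

theorem mem_post_toExt_iff {D : VASSData} {x : WConfig (Fin D.2.2.1) D.1 D.2.1} {s : RawConfig} :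
    s ∈ post D x.toExt.toRaw ↔ ∃ y : WConfig (Fin D.2.2.1) D.1 D.2.1,
      (StdVASS.ofData D).V.toOrderedTS.step x y ∧ y.toExt.toRaw = s := by
  rw [mem_post_iff]
  constructor
  · rintro ⟨t, ht, hf, rfl⟩
    obtain ⟨y, hy⟩ := exists_toExt_eq_fire hf
    exact ⟨y, WeightedVASS.step_iff.2 ⟨t, ht, hf, hy⟩, congrArg toRaw hy⟩
  · rintro ⟨y, hstep, rfl⟩
    obtain ⟨t, ht, hf, hy⟩ := WeightedVASS.step_iff.1 hstep
    exact ⟨t, ht, hf, (congrArg toRaw hy).symm⟩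

/-- All results of a given number of steps. -/
noncomputable def postIter (D : VASSData) (r : RawConfig) (k : ℕ) : List RawConfig :=
  (fun L => L.flatMap (post D))^[k] [r]

theorem coverable_iff {D : VASSData} {x y : WConfig (Fin D.2.2.1) D.1 D.2.1} :
    (StdVASS.ofData D).V.toOrderedTS.Coverable x y ↔
      ∃ k, ∃ s ∈ postIter D x.toExt.toRaw k, LE y.toExt.toRaw s := by
  have hsucc : ∀ k s, s ∈ postIter D x.toExt.toRaw (k + 1) ↔
      ∃ s' ∈ postIter D x.toExt.toRaw k, s ∈ post D s' := fun k s => by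
    rw [postIter, Function.iterate_succ_apply', List.mem_flatMap]
    rfl
  constructor
  · rintro ⟨y', hxy', hyy'⟩
    suffices ∃ k, (WConfig.toExt y').toRaw ∈ postIter D x.toExt.toRaw k by
      obtain ⟨k, hk⟩ := this
      exact ⟨k, _, hk, toRaw_le_iff.2 (WConfig.toExt_le_toExt.2 hyy')⟩
    clear hyy'
    induction hxy' with
    | refl => exact ⟨0, List.mem_singleton.2 rfl⟩
    | tail _ hstep ih =>
      obtain ⟨k, hk⟩ := ih
      exact ⟨k + 1, (hsucc k _).2 ⟨_, hk, mem_post_toExt_iff.2 ⟨_, hstep, rfl⟩⟩⟩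
  · rintro ⟨k, s, hs, hle⟩
    have hreach : ∀ k, ∀ s ∈ postIter D x.toExt.toRaw k, ∃ y' : WConfig (Fin D.2.2.1) D.1 D.2.1,
        (StdVASS.ofData D).V.toOrderedTS.steps x y' ∧ y'.toExt.toRaw = s := by
      intro k
      induction k with
      | zero =>
        intro s hs
        exact ⟨x, .refl, (List.mem_singleton.1 hs).symm⟩
      | succ k ih =>
        intro s hs
        obtain ⟨s', hs', hpost⟩ := (hsucc k s).1 hs
        obtain ⟨z, hz, rfl⟩ := ih s' hs'
        obtain ⟨y', hstep, rfl⟩ := mem_post_toExt_iff.1 hpost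
        exact ⟨y', hz.tail hstep, rfl⟩
    obtain ⟨y', hxy', rfl⟩ := hreach k s hs
    exact ⟨y', hxy', WConfig.toExt_le_toExt.1 (toRaw_le_iff.1 hle)⟩

theorem primrec_postIter : Primrec fun p : VASSData × RawConfig × ℕ => postIter p.1 p.2.1 p.2.2 := by
  refine nat_iterate (snd.comp snd) (list_cons.comp (fst.comp snd) (Primrec.const [])) ?_
  exact list_flatMap snd (primrec_post.comp (fst.comp (fst.comp fst)) snd)

/-- The lists describe a certificate that `s` is not coverable from `r`. -/
def IsSeparating (D : VASSData) (r s : RawConfig) (L : List RawConfig) : Prop :=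
  (∀ g ∈ L, Valid D g) ∧ (∃ g ∈ L, LE r g) ∧ (∀ g ∈ L, ¬ LE s g) ∧
    ∀ g ∈ L, ∀ h ∈ post D g, ∃ g' ∈ L, LE h g'

theorem exists_isSeparating_iff {D : VASSData} {x y : ExtConfig (Fin D.2.2.1) D.1 D.2.1} :
    (∃ L, IsSeparating D x.toRaw y.toRaw L) ↔
      ∃ L, (StdVASS.ofData D).V.IsSeparating x y L := by
  have key : ∀ L : List (ExtConfig (Fin D.2.2.1) D.1 D.2.1),
      IsSeparating D x.toRaw y.toRaw (L.map toRaw) ↔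
        (StdVASS.ofData D).V.IsSeparating x y L := by
    intro L
    have hvalid : ∀ g : ExtConfig (Fin D.2.2.1) D.1 D.2.1, Valid D g.toRaw ↔ g.Valid := fun g => by
      rw [valid_iff]
      exact ⟨fun ⟨g', h, h'⟩ => toRaw_injective h' ▸ h, fun h => ⟨g, h, rfl⟩⟩
    have hpost : ∀ (g : ExtConfig (Fin D.2.2.1) D.1 D.2.1) (P : RawConfig → Prop),
        (∀ h ∈ post D g.toRaw, P h) ↔
          ∀ t ∈ (StdVASS.ofData D).V.T, ExtConfig.Fireable t g → P (fire t g).toRaw := by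
      intro g P
      simp only [mem_post_iff]
      exact ⟨fun h t ht hf => h _ ⟨t, ht, hf, rfl⟩, fun h _ ⟨t, ht, hf, e⟩ => e ▸ h t ht hf⟩
    have hex : ∀ P : RawConfig → Prop, (∃ g ∈ L.map toRaw, P g) ↔ ∃ g ∈ L, P g.toRaw := fun P => by
      simp only [List.mem_map, exists_exists_and_eq_and]
    simp only [IsSeparating, List.forall_mem_map, hex, hvalid, hpost, toRaw_le_iff]
    refine ⟨fun h => ⟨h.1, h.2.1, h.2.2.1, fun g hg t ht hf => ?_⟩,
      fun h => ⟨h.1, h.2, h.3, fun g hg t ht hf => ?_⟩⟩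
    · obtain ⟨g', hg', hle⟩ := h.2.2.2 g hg t ht hf
      exact ⟨g', hg', toRaw_le_iff.1 hle⟩
    · obtain ⟨g', hg', hle⟩ := h.4 g hg t ht hf
      exact ⟨g', hg', toRaw_le_iff.2 hle⟩
  constructor
  · rintro ⟨L, hL⟩
    have hmem : L ∈ Set.range (List.map (toRaw (n := D.2.2.1) (d := D.1) (w := D.2.1))) := by
      rw [Set.range_list_map]
      intro r hr
      obtain ⟨g, -, hg⟩ := valid_iff.1 (hL.1 r hr)
      exact ⟨g, hg⟩
    obtain ⟨L, rfl⟩ := hmem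
    exact ⟨L, (key L).1 hL⟩
  · rintro ⟨L, hL⟩
    exact ⟨_, (key L).2 hL⟩

theorem primrecPred_isSeparating : PrimrecPred
    fun p : (VASSData × RawConfig × RawConfig) × List RawConfig =>
      IsSeparating p.1.1 p.1.2.1 p.1.2.2 p.2 := by
  refine .and ?_ (.and ?_ (.and ?_ ?_))
  · exact .forall_mem_of_primrec snd (primrecRel_valid.comp (fst.comp (fst.comp fst)) snd)
  · exact .exists_mem_of_primrec snd
      (primrecRel_le.comp (fst.comp (snd.comp (fst.comp fst))) snd)
  · exact .forall_mem_of_primrec snd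
      (primrecRel_le.comp (snd.comp (snd.comp (fst.comp fst))) snd).not
  · refine .forall_mem_of_primrec snd (.forall_mem_of_primrec
      (primrec_post.comp (fst.comp (fst.comp fst)) snd) ?_)
    exact .exists_mem_of_primrec (snd.comp (fst.comp fst)) (primrecRel_le.comp (snd.comp fst) snd)

section Decoding

variable {D : VASSData} {e e' : ℕ} {x y : WConfig (Fin D.2.2.1) D.1 D.2.1}

theorem ofCode_mem_post_iff (hx : WConfig.ofCode D.2.2.1 D.1 D.2.1 e = some x)
    (hy : WConfig.ofCode D.2.2.1 D.1 D.2.1 e' = some y) :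
    ofCode e' ∈ post D (ofCode e) ↔ (StdVASS.ofData D).V.toOrderedTS.step x y := by
  rw [ofCode_eq_toRaw hx, ofCode_eq_toRaw hy, mem_post_toExt_iff]
  constructor
  · rintro ⟨z, hz, h⟩
    exact WConfig.toExt_injective (toRaw_injective h) ▸ hz
  · exact fun h => ⟨y, h, rfl⟩

theorem ofCode_le_ofCode_iff (hx : WConfig.ofCode D.2.2.1 D.1 D.2.1 e = some x)
    (hy : WConfig.ofCode D.2.2.1 D.1 D.2.1 e' = some y) :
    LE (ofCode e) (ofCode e') ↔ x ≤ y := by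
  rw [ofCode_eq_toRaw hx, ofCode_eq_toRaw hy, toRaw_le_iff, WConfig.toExt_le_toExt]

theorem encard_post_eq (hx : WConfig.ofCode D.2.2.1 D.1 D.2.1 e = some x) {l : List RawConfig}
    (hl : l.Nodup) (hmem : ∀ s, s ∈ l ↔ s ∈ post D (ofCode e)) :
    ((StdVASS.ofData D).V.toOrderedTS.post x).encard = (l.length : ℕ∞) := by
  classical
  have hinj : Function.Injective
      fun y : WConfig (Fin D.2.2.1) D.1 D.2.1 => y.toExt.toRaw :=
    toRaw_injective.comp WConfig.toExt_injective
  have himage : (fun y : WConfig (Fin D.2.2.1) D.1 D.2.1 => y.toExt.toRaw) ''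
      (StdVASS.ofData D).V.toOrderedTS.post x = (l.toFinset : Set RawConfig) := by
    ext s
    rw [Finset.mem_coe, List.mem_toFinset, hmem, ofCode_eq_toRaw hx, mem_post_toExt_iff]
    rfl
  refine (hinj.encard_image _).symm.trans ?_
  rw [himage, Set.encard_coe_eq_coe_finsetCard, List.toFinset_card_of_nodup hl]

theorem coverable_iff_of_ofCode (hx : WConfig.ofCode D.2.2.1 D.1 D.2.1 e = some x)
    (hy : WConfig.ofCode D.2.2.1 D.1 D.2.1 e' = some y) :
    (StdVASS.ofData D).V.toOrderedTS.Coverable x y ↔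
      ∃ k, ∃ s ∈ postIter D (ofCode e) k, LE (ofCode e') s := by
  rw [ofCode_eq_toRaw hx, ofCode_eq_toRaw hy, coverable_iff]

theorem not_coverable_iff_of_ofCode (hx : WConfig.ofCode D.2.2.1 D.1 D.2.1 e = some x)
    (hy : WConfig.ofCode D.2.2.1 D.1 D.2.1 e' = some y) :
    ¬ (StdVASS.ofData D).V.toOrderedTS.Coverable x y ↔
      ∃ L, IsSeparating D (ofCode e) (ofCode e') L := by
  rw [ofCode_eq_toRaw hx, ofCode_eq_toRaw hy, exists_isSeparating_iff]
  exact (StdVASS.ofData D).V.not_coverable_iff x y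

end Decoding

/-! ### Codes of ideals -/

open Classical in
/-- The representation of ideals: a number encodes the ideal of the valid extended configuration
whose lists it encodes. -/
noncomputable def ideal (D : VASSData) (c : ℕ) :
    Option (Order.Ideal (WConfig (Fin D.2.2.1) D.1 D.2.1)) :=
  if h : ∃ g : ExtConfig (Fin D.2.2.1) D.1 D.2.1, g.Valid ∧ Encodable.decode c = some g.toRaw then
    some h.choose_spec.1.ideal
  else none

section Ideal

variable {D : VASSData} {c c' : ℕ}

theorem ideal_eq_some_of_valid {g : ExtConfig (Fin D.2.2.1) D.1 D.2.1} (hg : g.Valid)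
    (h : Encodable.decode c = some g.toRaw) : ideal D c = some hg.ideal := by
  have hex : ∃ g : ExtConfig (Fin D.2.2.1) D.1 D.2.1,
      g.Valid ∧ Encodable.decode c = some g.toRaw := ⟨g, hg, h⟩
  have heq : hex.choose = g :=
    toRaw_injective (Option.some_injective _ (hex.choose_spec.2.symm.trans h))
  rw [ideal, dif_pos hex]
  congr 2

theorem ideal_encode {g : ExtConfig (Fin D.2.2.1) D.1 D.2.1} (hg : g.Valid) :
    ideal D (Encodable.encode g.toRaw) = some hg.ideal :=
  ideal_eq_some_of_valid hg (Encodable.encodek _)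

theorem exists_of_ideal_eq_some {I : Order.Ideal (WConfig (Fin D.2.2.1) D.1 D.2.1)}
    (h : ideal D c = some I) : ∃ (g : ExtConfig (Fin D.2.2.1) D.1 D.2.1) (hg : g.Valid),
      Encodable.decode c = some g.toRaw ∧ hg.ideal = I := by
  rw [ideal] at h
  split_ifs at h with hex
  exact ⟨hex.choose, hex.choose_spec.1, hex.choose_spec.2, Option.some_injective _ h⟩

theorem isSome_ideal_iff : (ideal D c).isSome = true ↔
    ∃ r ∈ (Encodable.decode c : Option RawConfig).toList, Valid D r := by
  simp only [Option.mem_toList, valid_iff]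
  constructor
  · intro h
    obtain ⟨I, hI⟩ := Option.isSome_iff_exists.1 h
    obtain ⟨g, hg, he, -⟩ := exists_of_ideal_eq_some hI
    exact ⟨_, he, g, hg, rfl⟩
  · rintro ⟨_, he, g, hg, rfl⟩
    rw [ideal_eq_some_of_valid hg he]
    rfl

theorem exists_ideal_eq (I : Order.Ideal (WConfig (Fin D.2.2.1) D.1 D.2.1)) :
    ∃ c, ideal D c = some I := by
  obtain ⟨g, hg, rfl⟩ := exists_valid_of_ideal I
  exact ⟨_, ideal_encode hg⟩

theorem ideal_principal {e : ℕ} {x : WConfig (Fin D.2.2.1) D.1 D.2.1}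
    (hx : WConfig.ofCode D.2.2.1 D.1 D.2.1 e = some x) :
    ideal D (Encodable.encode (ofCode e)) = some (Order.Ideal.principal x) := by
  rw [ofCode_eq_toRaw hx, ideal_encode x.toExt_valid]
  exact congrArg some (Order.Ideal.ext (Set.ext fun _ => WConfig.toExt_le_toExt))

theorem ideal_subset_iff {I J : Order.Ideal (WConfig (Fin D.2.2.1) D.1 D.2.1)}
    (hI : ideal D c = some I) (hJ : ideal D c' = some J) :
    (∃ r ∈ (Encodable.decode c : Option RawConfig).toList,
      ∃ s ∈ (Encodable.decode c' : Option RawConfig).toList, LE r s) ↔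
    (I : Set (WConfig (Fin D.2.2.1) D.1 D.2.1)) ⊆ J := by
  obtain ⟨g, hg, he, rfl⟩ := exists_of_ideal_eq_some hI
  obtain ⟨g', hg', he', rfl⟩ := exists_of_ideal_eq_some hJ
  simp only [he, he', Option.toList_some, List.mem_singleton, exists_eq_left]
  rw [toRaw_le_iff, hg.le_iff hg']
  rfl

/-- The codes of the ideals whose union is the downward closure of the successors. -/
noncomputable def postIdeal (D : VASSData) (c : ℕ) : List ℕ :=
  ((Encodable.decode c : Option RawConfig).toList.flatMap (post D)).map Encodable.encode

theorem postIdeal_spec {I : Order.Ideal (WConfig (Fin D.2.2.1) D.1 D.2.1)}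
    (hI : ideal D c = some I) : (∀ b ∈ postIdeal D c, (ideal D b).isSome = true) ∧
      ∀ z, z ∈ lowerClosure ((StdVASS.ofData D).V.toOrderedTS.postSet
          (I : Set (WConfig (Fin D.2.2.1) D.1 D.2.1))) ↔
        ∃ b ∈ postIdeal D c, ∃ J, ideal D b = some J ∧ z ∈ J := by
  obtain ⟨g, hg, he, rfl⟩ := exists_of_ideal_eq_some hI
  have hmem : ∀ b, b ∈ postIdeal D c ↔ ∃ t ∈ (StdVASS.ofData D).V.T,
      ExtConfig.Fireable t g ∧ Encodable.encode (fire t g).toRaw = b := by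
    intro b
    simp only [postIdeal, he, Option.toList_some, List.flatMap_singleton, List.mem_map,
      mem_post_iff]
    exact ⟨fun ⟨_, ⟨t, ht, hf, h⟩, h'⟩ => ⟨t, ht, hf, h ▸ h'⟩,
      fun ⟨t, ht, hf, h⟩ => ⟨_, ⟨t, ht, hf, rfl⟩, h⟩⟩
  refine ⟨fun b hb => ?_, fun z => ?_⟩
  · obtain ⟨t, -, hf, rfl⟩ := (hmem b).1 hb
    refine Option.isSome_iff_exists.2 ⟨_, ideal_encode (hg.valid_fire hf)⟩
  · have hlower : z ∈ lowerClosure ((StdVASS.ofData D).V.toOrderedTS.postSet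
        (hg.ideal : Set (WConfig (Fin D.2.2.1) D.1 D.2.1))) ↔
        ∃ y x : WConfig (Fin D.2.2.1) D.1 D.2.1, x.toExt ≤ g ∧
          (StdVASS.ofData D).V.toOrderedTS.step x y ∧ z ≤ y := by
      constructor
      · rintro ⟨y, ⟨x, hx, hstep⟩, hzy⟩
        exact ⟨y, x, hx, hstep, hzy⟩
      · rintro ⟨y, x, hx, hstep, hzy⟩
        exact ⟨y, ⟨x, hx, hstep⟩, hzy⟩
    refine (hlower.trans (hg.mem_lowerClosure_postSet_iff (StdVASS.ofData D).V z)).trans ?_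
    constructor
    · rintro ⟨t, ht, hf, hz⟩
      exact ⟨_, (hmem _).2 ⟨t, ht, hf, rfl⟩, _, ideal_encode (hg.valid_fire hf), hz⟩
    · rintro ⟨b, hb, J, hJ, hz⟩
      obtain ⟨t, ht, hf, rfl⟩ := (hmem b).1 hb
      rw [show ideal D (Encodable.encode (fire t g).toRaw) = _ from
        ideal_encode (hg.valid_fire hf)] at hJ
      obtain rfl := Option.some_injective _ hJ
      exact ⟨t, ht, hf, hz⟩

end Ideal

theorem primrec_toList_decode {α : Type*} [Primcodable α] :
    Primrec fun e : ℕ => (Encodable.decode e : Option α).toList :=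
  optionToList.comp Primrec.decode

theorem primrec_postIdeal : Primrec₂ postIdeal :=
  list_map (list_flatMap (primrec_toList_decode.comp snd)
    (primrec_post.comp (fst.comp fst) snd)) (Primrec.encode.comp snd)

end RawConfig

/-! ### Effectiveness of the class -/

-- Keeps unification from computing with the decoding function applied to a variable.
attribute [local irreducible] Denumerable.ofNat

namespace weightedVASSClass

open Primrec RawConfig

theorem decides_of_computablePred {C : TSClass} {P : ℕ × ℕ × ℕ → Prop} (hP : ComputablePred P)
    {R : (i : ℕ) → (C.sys i).State → (C.sys i).State → Prop}
    (h : ∀ i e e' x y, C.rep i e = some x → C.rep i e' = some y → (P (i, e, e') ↔ R i x y)) :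
    ∃ M, C.Decides M R := by
  obtain ⟨M, hM, hMP⟩ := hP.exists_partrec
  refine ⟨M, hM, fun i e e' x y hx hy => ?_⟩
  obtain ⟨b, hb, hbP⟩ := hMP (i, e, e')
  exact ⟨b, hb, hbP.trans (h i e e' x y hx hy)⟩

theorem primrec_data : Primrec (Denumerable.ofNat VASSData) := Primrec.ofNat _

theorem primrecPred_isSome_rep :
    PrimrecPred fun p : ℕ × ℕ => (weightedVASSClass.rep p.1 p.2).isSome = true := by
  have hc : Primrec fun p : ℕ × ℕ => ofCode p.2 := primrec_ofCode.comp snd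
  have hd : Primrec fun p : ℕ × ℕ => Denumerable.ofNat VASSData p.1 := primrec_data.comp fst
  exact PrimrecPred.of_eq (.and (nat_lt.comp (fst.comp hc) (fst.comp (snd.comp (snd.comp hd))))
    (.and (Primrec.eq.comp (list_length.comp (fst.comp (snd.comp hc))) (fst.comp hd))
      (Primrec.eq.comp (list_length.comp (snd.comp (snd.comp hc))) (fst.comp (snd.comp hd)))))
    fun p => isSome_ofCode_iff.symm

theorem primrec_post_ofCode :
    Primrec₂ fun i e : ℕ => post (Denumerable.ofNat VASSData i) (ofCode e) :=
  primrec_post.comp (primrec_data.comp fst) (primrec_ofCode.comp snd)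

theorem effective : weightedVASSClass.Effective := by
  refine ⟨primrecPred_isSome_rep.computablePred, ?_, ?_⟩
  · have hP : PrimrecPred fun p : ℕ × ℕ × ℕ =>
        ofCode p.2.2 ∈ post (Denumerable.ofNat VASSData p.1) (ofCode p.2.1) :=
      PrimrecPred.of_eq (.exists_mem_of_primrec (primrec_post_ofCode.comp fst (fst.comp snd))
        (Primrec.eq.comp snd (primrec_ofCode.comp (snd.comp (snd.comp fst))))) fun p =>
          exists_eq_right
    exact decides_of_computablePred hP.computablePred fun i e e' x y hx hy =>
      ofCode_mem_post_iff (D := Denumerable.ofNat VASSData i) hx hy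
  · have hP : PrimrecPred fun p : ℕ × ℕ × ℕ => LE (ofCode p.2.1) (ofCode p.2.2) :=
      primrecRel_le.comp (primrec_ofCode.comp (fst.comp snd)) (primrec_ofCode.comp (snd.comp snd))
    exact decides_of_computablePred hP.computablePred fun i e e' x y hx hy =>
      ofCode_le_ofCode_iff (D := Denumerable.ofNat VASSData i) hx hy

theorem postEffective : weightedVASSClass.PostEffective := by
  refine ⟨effective, ?_⟩
  obtain ⟨f, hf, hfl⟩ := Primrec.exists_dedup (α := RawConfig)
  refine ⟨fun p => Part.some (some (f (post (Denumerable.ofNat VASSData p.1) (ofCode p.2))).length),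
    Computable.partrec (Primrec.to_comp (option_some.comp (list_length.comp
      (hf.comp primrec_post_ofCode)))), fun i e x hx => ⟨_, Part.mem_some _, ?_⟩⟩
  exact encard_post_eq (D := Denumerable.ofNat VASSData i) hx (hfl _).1 (hfl _).2

theorem ideallyEffective : weightedVASSClass.IdeallyEffective := by
  refine ⟨fun i => ideal (Denumerable.ofNat VASSData i), fun i => exists_ideal_eq, ?_, ?_, ?_, ?_⟩
  · refine PrimrecPred.computablePred (PrimrecPred.of_eq ?_ fun p => isSome_ideal_iff.symm)
    exact .exists_mem_of_primrec (primrec_toList_decode.comp snd)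
      (primrecRel_valid.comp (primrec_data.comp (fst.comp fst)) snd)
  · exact ⟨fun p => Part.some (Encodable.encode (ofCode p.2)),
      Computable.partrec (Primrec.to_comp (Primrec.encode.comp (primrec_ofCode.comp snd))),
      fun i e x hx => ⟨_, Part.mem_some _, ideal_principal hx⟩⟩
  · have hP : PrimrecPred fun p : ℕ × ℕ × ℕ =>
        ∃ r ∈ (Encodable.decode p.2.1 : Option RawConfig).toList,
          ∃ s ∈ (Encodable.decode p.2.2 : Option RawConfig).toList, LE r s :=
      .exists_mem_of_primrec (primrec_toList_decode.comp (fst.comp snd))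
        (.exists_mem_of_primrec (primrec_toList_decode.comp (snd.comp (snd.comp fst)))
          (primrecRel_le.comp (snd.comp fst) snd))
    obtain ⟨M, hM, hMP⟩ := hP.computablePred.exists_partrec
    refine ⟨M, hM, fun i e e' I J hI hJ => ?_⟩
    obtain ⟨b, hb, hbP⟩ := hMP (i, e, e')
    exact ⟨b, hb, hbP.trans (ideal_subset_iff hI hJ)⟩
  · exact ⟨fun p => Part.some (postIdeal (Denumerable.ofNat VASSData p.1) p.2),
      Computable.partrec (Primrec.to_comp (primrec_postIdeal.comp (primrec_data.comp fst) snd)),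
      fun i e I hI => ⟨_, Part.mem_some _, postIdeal_spec hI⟩⟩

/-- Coverability is enumerable by forward search, and its complement by enumerating the
certificates of non-coverability. -/
theorem coverabilityDecidable : weightedVASSClass.CoverabilityDecidable := by
  -- Pairs of numbers that are not codes of configurations are put into the complement, so that
  -- the two enumerable predicates are complementary on all inputs.
  let ok : ℕ × ℕ × ℕ → Prop := fun p =>
    (weightedVASSClass.rep p.1 p.2.1).isSome = true ∧ (weightedVASSClass.rep p.1 p.2.2).isSome = true
  have hok : PrimrecPred ok :=
    .and (primrecPred_isSome_rep.comp (fst.pair (fst.comp snd)))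
      (primrecPred_isSome_rep.comp (fst.pair (snd.comp snd)))
  let P : ℕ × ℕ × ℕ → Prop := fun p => ∃ k, ok p ∧
    ∃ s ∈ postIter (Denumerable.ofNat VASSData p.1) (ofCode p.2.1) k, LE (ofCode p.2.2) s
  have hP : REPred P := by
    refine REPred.exists_nat (.and (hok.comp fst) (.exists_mem_of_primrec
      (primrec_postIter.comp (.pair (primrec_data.comp (fst.comp fst))
        (.pair (primrec_ofCode.comp (fst.comp (snd.comp fst))) snd))) ?_))
    exact primrecRel_le.comp (primrec_ofCode.comp (snd.comp (snd.comp (fst.comp fst)))) snd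
  let N : ℕ × ℕ × ℕ → Prop := fun p => ∃ m, ¬ ok p ∨
    ∃ L ∈ (Encodable.decode m : Option (List RawConfig)).toList,
      IsSeparating (Denumerable.ofNat VASSData p.1) (ofCode p.2.1) (ofCode p.2.2) L
  have hN : REPred N := by
    refine REPred.exists_nat (.or (hok.not.comp fst) (.exists_mem_of_primrec
      (primrec_toList_decode.comp snd) ?_))
    have hp : Primrec fun a : ((ℕ × ℕ × ℕ) × ℕ) × List RawConfig => a.1.1 := fst.comp fst
    exact primrecPred_isSeparating.comp (.pair (.pair (primrec_data.comp (fst.comp hp))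
      (.pair (primrec_ofCode.comp (fst.comp (snd.comp hp)))
        (primrec_ofCode.comp (snd.comp (snd.comp hp))))) snd)
  have hcov : ∀ i e e' x y, weightedVASSClass.rep i e = some x →
      weightedVASSClass.rep i e' = some y →
      (P (i, e, e') ↔ (weightedVASSClass.sys i).Coverable x y) := by
    intro i e e' x y hx hy
    have hok' : ok (i, e, e') := ⟨by rw [hx]; rfl, by rw [hy]; rfl⟩
    simp only [P, and_iff_right hok']
    exact (coverable_iff_of_ofCode (D := Denumerable.ofNat VASSData i) hx hy).symm
  have hnot : ∀ i e e' x y, weightedVASSClass.rep i e = some x →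
      weightedVASSClass.rep i e' = some y →
      (N (i, e, e') ↔ ¬ (weightedVASSClass.sys i).Coverable x y) := by
    intro i e e' x y hx hy
    have hok' : ok (i, e, e') := ⟨by rw [hx]; rfl, by rw [hy]; rfl⟩
    simp only [N, not_true_eq_false, hok', false_or, Option.mem_toList]
    refine Iff.trans ⟨?_, ?_⟩
      (not_coverable_iff_of_ofCode (D := Denumerable.ofNat VASSData i) hx hy).symm
    · rintro ⟨m, L, -, hL⟩
      exact ⟨L, hL⟩
    · rintro ⟨L, hL⟩
      exact ⟨Encodable.encode L, L, Encodable.encodek L, hL⟩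
  refine decides_of_computablePred
    (ComputablePred.computable_iff_re_compl_re'.2 ⟨hP, hN.of_eq ?_⟩) hcov
  rintro ⟨i, e, e'⟩
  by_cases hp : ok (i, e, e')
  · obtain ⟨x, hx⟩ := Option.isSome_iff_exists.1 hp.1
    obtain ⟨y, hy⟩ := Option.isSome_iff_exists.1 hp.2
    rw [hnot i e e' x y hx hy, hcov i e e' x y hx hy]
  · exact iff_of_true ⟨0, Or.inl hp⟩ fun ⟨_, h, _⟩ => hp h

end weightedVASSClass

theorem mainTheorem9 :
    (∀ (Q : Type*) [Finite Q] (d w : ℕ) (V : WeightedVASS Q d w),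
      V.toOrderedTS.IsWBTS ∧
      (Nonempty Q → 0 < w → ¬ V.toOrderedTS.IsWSTS)) ∧
    (∀ i, (weightedVASSClass.sys i).IsWBTS) ∧
    weightedVASSClass.PostEffective ∧
    weightedVASSClass.IdeallyEffective ∧
    weightedVASSClass.CoverabilityDecidable := by
  refine ⟨fun Q _ d w V => ⟨V.toOrderedTS_isWBTS, V.not_isWSTS⟩,
    fun i => (StdVASS.enum i).V.toOrderedTS_isWBTS, weightedVASSClass.postEffective,
    weightedVASSClass.ideallyEffective, weightedVASSClass.coverabilityDecidable⟩
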